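/- Fix an integer $\rho\ge 0$. A \emph{triangular DGA} is a free associative unital $\mathbb Z/2$-algebra $\mathcal A=\mathbb Z/2\langle x_1,\dots,x_n\rangle$ on a finite set of generators with degrees in $\mathbb Z/\rho$, with a differential $\partial$ (a derivation of degree $-1$ with $\partial^2=0$) such that, for some ordering of the generators, $\partial x_i\in\mathbb Z/2\langle x_1,\dots,x_{i-1}\rangle$. DGA maps are graded unital algebra maps commuting with $\partial$; two of them, $f,g$, are \emph{homotopic}, $f\simeq g$, if $f-g=\partial K+K\partial$ for a linear map $K$ of degree $1$ with $K(xy)=K(x)g(y)+f(x)K(y)$. A \emph{stabilization} $\mathcal A*S$ adjoins finitely many pairs of generators $a_j,b_j$ with $\partial a_j=b_j$. An isomorphism is \emph{tame} if it is a composition of degree-preserving bijections of generators and of elementary automorphisms (which send one generator $x$ to $x+w$, with $w$ homogeneous of degree $|x|$ in the subalgebra generated by the other generators, and fix all other generators). An \emph{immersed DGA map} $M$ from $\mathcal A_1$ to $\mathcal A_2$ is a diagram of DGA maps $\mathcal A_1\xrightarrow{f}\mathcal B\xleftarrow{i}\mathcal A_2$ of triangular DGAs, where $i$ is induced by an injection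 of generating sets. $M$ and $M'=(\mathcal A_1\xrightarrow{f'}\mathcal B'\xleftarrow{i'}\mathcal A_2)$ are \emph{immersed homotopic} if there is a tame DGA isomorphism $\varphi:\mathcal B*S\to\mathcal B'*S'$ between stabilizations with $\varphi\circ i=i'$ and $\varphi\circ f\simeq f'$. Given $M_k=(\mathcal A_k\xrightarrow{f_k}\mathcal B_k\xleftarrow{i_k}\mathcal A_{k+1})$, $k=1,2$, the composition is $M_2\circ M_1=(\mathcal A_1\xrightarrow{p_1f_1}\mathcal B\xleftarrow{p_2i_2}\mathcal A_3)$, where $\mathcal B$, with $p_k:\mathcal B_k\to\mathcal B$, is the push-out of $i_1$ and $f_2$, with generators those of $\mathcal B_1$ not coming from $\mathcal A_2$ together with those of $\mathcal B_2$. The category $\mathfrak{DGA}^\rho_{im}$ has triangular DGAs as objects, classes $[M]$ of immersed DGA maps under immersed homotopy as morphisms, composition $[M_2]\circ[M_1]=[M_2\circ M_1]$, and identities $[\mathcal A\xrightarrow{\mathrm{id}}\mathcal A\xleftarrow{\mathrm{id}}\mathcal A]$. An \emph{augmentation} of $\mathcal A$ is a DGA map $\mathcal A\to(\mathbb Z/2,0)$,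 with $\mathbb Z/2$ in degree $0$; $\mathrm{Aug}(\mathcal A)/{\sim}$ is the set of homotopy classes of augmentations. The \emph{induced augmentation set} of $M$ is $I(M)=\{([\alpha\circ i],[\alpha\circ f]) : \alpha \text{ an augmentation of } \mathcal B\}\subset \mathrm{Aug}(\mathcal A_2)/{\sim}\times\mathrm{Aug}(\mathcal A_1)/{\sim}$. Let $\mathfrak{Rel}$ be the category of sets and relations, where for $R\subset X\times Y$ and $S\subset Y\times Z$ one puts $S\circ R=\{(x,z):\exists y,\ (x,y)\in R,\ (y,z)\in S\}$. \textbf{Proposition.} $\mathfrak{DGA}^\rho_{im}$ is a category (in particular its composition is well defined), and $\mathcal A\mapsto\mathrm{Aug}(\mathcal A)/{\sim}$, $[M]\mapsto I(M)$ is a well-defined contravariant functor $\mathfrak{DGA}^\rho_{im}\to\mathfrak{Rel}$. In particular, let $L$ be any contravariant functor from a category $\mathcal C$ to $\mathfrak{DGA}^\rho_{im}$ (for instance, the immersed Legendrian contact homology functor, where $\mathcal C$ is the category of $\rho$-graded Legendrian knots, equipped with regular metrics, and conical Legendrian isotopy classes of $\rho$-graded conical Legendrian cobordisms, composed by concatenation).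 For a morphism $\Sigma$ of $\mathcal C$ put $I_\Sigma=I(M_\Sigma)$, where $M_\Sigma$ is any immersed DGA map representing $L(\Sigma)$. Then for all $\Sigma_i:\Lambda_{i+1}\to\Lambda_i$, $i=1,2$, $$I_{\Sigma_1\circ\Sigma_2}=I_{\Sigma_1}\circ I_{\Sigma_2}.$$ -/

import Mathlib

open CategoryTheory

universe u v w

namespace ImmersedDGA

/-! ### Free graded algebras over `ℤ/2` -/

/-- The free associative unital `ℤ/2`-algebra on a generating set. -/
abbrev Free (G : Type u) : Type u := FreeAlgebra (ZMod 2) G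

/-- The generator of `Free G` given by `x : G`. -/
abbrev gen {G : Type u} (x : G) : Free G := FreeAlgebra.ι (ZMod 2) x

/-- The word `x₁ ⋯ xₘ` in the generators. -/
def word {G : Type u} (l : List G) : Free G := (l.map gen).prod

/-- The homogeneous part of degree `k` of the free algebra whose generators have degrees `deg`:
the span of the words of total degree `k`. -/
def homog {G : Type u} {ρ : ℕ} (deg : G → ZMod ρ) (k : ZMod ρ) : Submodule (ZMod 2) (Free G) :=
  Submodule.span (ZMod 2) {p | ∃ l : List G, (l.map deg).sum = k ∧ p = word l}

/-- The unital subalgebra generated by a set of generators. -/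
def subalg {G : Type u} (Y : Set G) : Subalgebra (ZMod 2) (Free G) :=
  Algebra.adjoin (ZMod 2) (gen '' Y)

/-- The algebra map renaming generators. -/
def rename {G : Type u} {H : Type v} (e : G → H) : Free G →ₐ[ZMod 2] Free H :=
  FreeAlgebra.lift (ZMod 2) (fun x => gen (e x))

@[simp] theorem rename_gen {G : Type u} {H : Type v} (e : G → H) (x : G) :
    rename e (gen x) = gen (e x) := by
  simp [rename, gen]

theorem gen_mem_homog {G : Type u} {ρ : ℕ} (deg : G → ZMod ρ) (x : G) :
    gen x ∈ homog deg (deg x) :=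
  Submodule.subset_span ⟨[x], by simp, by simp [word]⟩

theorem one_mem_homog {G : Type u} {ρ : ℕ} (deg : G → ZMod ρ) : (1 : Free G) ∈ homog deg 0 :=
  Submodule.subset_span ⟨[], by simp, by simp [word]⟩

theorem mul_mem_homog {G : Type u} {ρ : ℕ} (deg : G → ZMod ρ) {j k : ZMod ρ} {p q : Free G}
    (hp : p ∈ homog deg j) (hq : q ∈ homog deg k) : p * q ∈ homog deg (j + k) := by
  have h : p * q ∈ homog deg j * homog deg k := Submodule.mul_mem_mul hp hq
  refine (?_ : homog deg j * homog deg k ≤ homog deg (j + k)) h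
  unfold homog
  rw [Submodule.span_mul_span]
  refine Submodule.span_mono ?_
  rintro _ ⟨_, ⟨l, hl, rfl⟩, _, ⟨m, hm, rfl⟩, rfl⟩
  exact ⟨l ++ m, by simp [hl, hm], by simp [word]⟩

/-- An algebra map that preserves the degrees of the generators preserves the grading. -/
theorem map_mem_homog {G : Type u} {H : Type v} {ρ : ℕ} {deg : G → ZMod ρ} {deg' : H → ZMod ρ}
    (φ : Free G →ₐ[ZMod 2] Free H) (h : ∀ x, φ (gen x) ∈ homog deg' (deg x))
    {k : ZMod ρ} {p : Free G} (hp : p ∈ homog deg k) : φ p ∈ homog deg' k := by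
  refine (?_ : homog deg k ≤ (homog deg' k).comap φ.toLinearMap) hp
  refine Submodule.span_le.2 ?_
  rintro _ ⟨l, rfl, rfl⟩
  change φ (word l) ∈ homog deg' _
  clear hp
  induction l with
  | nil => simpa [word] using one_mem_homog deg'
  | cons a l ih =>
    have : φ (word (a :: l)) = φ (gen a) * φ (word l) := by simp [word]
    rw [this]
    simpa using mul_mem_homog deg' (h a) ih

/-! ### Derivations of a free algebra -/

/-- The derivation of the free algebra with prescribed values on the generators. -/
def der {G : Type u} (δ : G → Free G) : Free G →ₗ[ZMod 2] Free G :=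
  (TrivSqZeroExt.sndHom (Free G) (Free G)).restrictScalars (ZMod 2) ∘ₗ
    (FreeAlgebra.lift (ZMod 2)
      (fun x => (TrivSqZeroExt.inl (gen x) + TrivSqZeroExt.inr (δ x) :
        TrivSqZeroExt (Free G) (Free G)))).toLinearMap

theorem der_gen {G : Type u} (δ : G → Free G) (x : G) : der δ (gen x) = δ x := by
  simp [der, gen]

theorem der_mul {G : Type u} (δ : G → Free G) (p q : Free G) :
    der δ (p * q) = der δ p * q + p * der δ q := by
  have h : ∀ p : Free G, (FreeAlgebra.lift (ZMod 2)
      (fun x => (TrivSqZeroExt.inl (gen x) + TrivSqZeroExt.inr (δ x) :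
        TrivSqZeroExt (Free G) (Free G))) p).fst = p := by
    intro p
    have : ((TrivSqZeroExt.fstHom (ZMod 2) (Free G) (Free G)).comp (FreeAlgebra.lift (ZMod 2)
      (fun x => (TrivSqZeroExt.inl (gen x) + TrivSqZeroExt.inr (δ x) :
        TrivSqZeroExt (Free G) (Free G))))) = AlgHom.id (ZMod 2) (Free G) := by
      ext x
      simp [gen]
    exact DFunLike.congr_fun this p
  change TrivSqZeroExt.snd (FreeAlgebra.lift (ZMod 2)
      (fun x => (TrivSqZeroExt.inl (gen x) + TrivSqZeroExt.inr (δ x) :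
        TrivSqZeroExt (Free G) (Free G))) (p * q)) = _
  rw [map_mul, TrivSqZeroExt.snd_mul, h, h, smul_eq_mul, MulOpposite.smul_eq_mul_unop,
    MulOpposite.unop_op, add_comm]
  rfl

/-- Two linear maps out of a free algebra which are derivations over the same pair of algebra maps
and agree on the generators are equal. -/
theorem derivation_ext {G : Type u} {B : Type v} [Ring B] [Algebra (ZMod 2) B]
    (f g : Free G →ₐ[ZMod 2] B) (D E : Free G →ₗ[ZMod 2] B)
    (hD : ∀ p q, D (p * q) = D p * g q + f p * D q)
    (hE : ∀ p q, E (p * q) = E p * g q + f p * E q)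
    (h : ∀ x, D (gen x) = E (gen x)) (p : Free G) : D p = E p := by
  have h1 : ∀ F : Free G →ₗ[ZMod 2] B, (∀ p q, F (p * q) = F p * g q + f p * F q) → F 1 = 0 := by
    intro F hF
    simpa using hF 1 1
  induction p using FreeAlgebra.induction with
  | grade0 r => rw [Algebra.algebraMap_eq_smul_one, map_smul, map_smul, h1 D hD, h1 E hE]
  | grade1 x => exact h x
  | mul p q hp hq => rw [hD, hE, hp, hq]
  | add p q hp hq => rw [map_add, map_add, hp, hq]

theorem der_mem_homog {G : Type u} {ρ : ℕ} (deg : G → ZMod ρ) (δ : G → Free G)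
    (h : ∀ x, δ x ∈ homog deg (deg x - 1)) {k : ZMod ρ} {p : Free G} (hp : p ∈ homog deg k) :
    der δ p ∈ homog deg (k - 1) := by
  refine (?_ : homog deg k ≤ (homog deg (k - 1)).comap (der δ)) hp
  refine Submodule.span_le.2 ?_
  rintro _ ⟨l, rfl, rfl⟩
  change der δ (word l) ∈ homog deg _
  clear hp
  induction l with
  | nil =>
    have h1 : der δ (1 : Free G) = 0 := by simpa using der_mul δ 1 1
    simp [word, h1]
  | cons a l ih =>
    have hw : word (a :: l) = gen a * word l := by simp [word]
    rw [hw, der_mul, der_gen]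
    refine add_mem ?_ ?_
    · have := mul_mem_homog deg (h a) (Submodule.subset_span ⟨l, rfl, rfl⟩ :
        word l ∈ homog deg (l.map deg).sum)
      convert this using 2
      simp only [List.map_cons, List.sum_cons]; ring
    · have := mul_mem_homog deg (gen_mem_homog deg a) ih
      convert this using 2
      simp only [List.map_cons, List.sum_cons]; ring

/-! ### Triangular DGAs -/

/-- A triangular based DGA over `ℤ/2`, graded by `ℤ/ρ`: a free algebra on a finite set of graded
generators with a differential of degree `-1`, such that for some ordering of the generators
(given by an injective rank function) the differential of a generator lies in the subalgebra
generated by the preceding ones. -/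
structure TriDGA (ρ : ℕ) : Type (u + 1) where
  /-- The generating set. -/
  G : Type u
  finite : Finite G
  deg : G → ZMod ρ
  d : Free G →ₗ[ZMod 2] Free G
  d_mul : ∀ p q, d (p * q) = d p * q + p * d q
  d_homog : ∀ k, ∀ p ∈ homog deg k, d p ∈ homog deg (k - 1)
  d_d : ∀ p, d (d p) = 0
  triangular : ∃ r : G → ℕ, Function.Injective r ∧ ∀ x, d (gen x) ∈ subalg {y | r y < r x}

/-- The triangular DGA whose differential is given by its values on the generators. -/
def TriDGA.ofGen {ρ : ℕ} (G : Type u) (hG : Finite G) (deg : G → ZMod ρ) (δ : G → Free G)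
    (hδ : ∀ x, δ x ∈ homog deg (deg x - 1)) (hd : ∀ x, der δ (δ x) = 0)
    (ht : ∃ r : G → ℕ, Function.Injective r ∧ ∀ x, δ x ∈ subalg {y | r y < r x}) : TriDGA ρ where
  G := G
  finite := hG
  deg := deg
  d := der δ
  d_mul := der_mul δ
  d_homog _ _ hp := der_mem_homog deg δ hδ hp
  d_d := by
    refine derivation_ext (AlgHom.id _ _) (AlgHom.id _ _) (der δ ∘ₗ der δ) 0 ?_ ?_ ?_
    · intro p q
      have h2 : ∀ a : Free G, a + a = 0 := fun a => by
        rw [← two_smul (ZMod 2) a, (by decide : (2 : ZMod 2) = 0), zero_smul]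
      have := h2 (der δ p * der δ q)
      simp only [LinearMap.comp_apply, der_mul, map_add, AlgHom.id_apply]
      calc _ = der δ (der δ p) * q + p * der δ (der δ q)
            + (der δ p * der δ q + der δ p * der δ q) := by abel
        _ = _ := by rw [this, add_zero]
    · simp
    · intro x; simpa [der_gen] using hd x
  triangular := by simpa [der_gen] using ht

/-- A DGA morphism. -/
@[ext] structure Hom {ρ : ℕ} (A B : TriDGA.{u} ρ) where
  toAlgHom : Free A.G →ₐ[ZMod 2] Free B.G
  map_homog : ∀ k, ∀ p ∈ homog A.deg k, toAlgHom p ∈ homog B.deg k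
  map_d : ∀ p, toAlgHom (A.d p) = B.d (toAlgHom p)

theorem map_d_of_gen {ρ : ℕ} {A B : TriDGA.{u} ρ} (φ : Free A.G →ₐ[ZMod 2] Free B.G)
    (h : ∀ x, φ (A.d (gen x)) = B.d (φ (gen x))) (p : Free A.G) :
    φ (A.d p) = B.d (φ p) :=
  derivation_ext φ φ (φ.toLinearMap ∘ₗ A.d) (B.d ∘ₗ φ.toLinearMap)
    (fun p q => by simp [A.d_mul]) (fun p q => by simp [B.d_mul]) h p

/-- A DGA morphism from its values on the generators. -/
def Hom.ofGen {ρ : ℕ} {A B : TriDGA.{u} ρ} (φ : Free A.G →ₐ[ZMod 2] Free B.G)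
    (h₁ : ∀ x, φ (gen x) ∈ homog B.deg (A.deg x))
    (h₂ : ∀ x, φ (A.d (gen x)) = B.d (φ (gen x))) : Hom A B where
  toAlgHom := φ
  map_homog _ _ hp := map_mem_homog φ h₁ hp
  map_d := map_d_of_gen φ h₂

/-- The identity morphism. -/
def Hom.id {ρ : ℕ} (A : TriDGA.{u} ρ) : Hom A A where
  toAlgHom := AlgHom.id _ _
  map_homog _ _ hp := hp
  map_d _ := rfl

/-- `g.comp f` is the composition `g ∘ f`. -/
def Hom.comp {ρ : ℕ} {A B C : TriDGA.{u} ρ} (g : Hom B C) (f : Hom A B) : Hom A C where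
  toAlgHom := g.toAlgHom.comp f.toAlgHom
  map_homog k p hp := g.map_homog k _ (f.map_homog k p hp)
  map_d p := by simp [f.map_d, g.map_d]

/-- DGA homotopy `f ≃ g`: there is an `(f, g)`-derivation `K` of degree `1` with
`f - g = ∂ K + K ∂`. -/
def Homotopic {ρ : ℕ} {A B : TriDGA.{u} ρ} (f g : Hom A B) : Prop :=
  ∃ K : Free A.G →ₗ[ZMod 2] Free B.G,
    (∀ k, ∀ p ∈ homog A.deg k, K p ∈ homog B.deg (k + 1)) ∧
    (∀ p q, K (p * q) = K p * g.toAlgHom q + f.toAlgHom p * K q) ∧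
    ∀ p, f.toAlgHom p - g.toAlgHom p = B.d (K p) + K (A.d p)

/-! ### Stable tame isomorphisms -/

/-- The generators of the stabilization: those of `A`, the `a_j` (`inr (inl j)`), and the `b_j`
(`inr (inr j)`). -/
abbrev StabGen (G J : Type u) : Type u := G ⊕ (J ⊕ J)

/-- The stabilization `A * S`, where `S` has generators `a_j, b_j` (`j : J`, a finite set) with
`|a_j| = c j`, `|b_j| = c j - 1`, `∂ a_j = b_j` and `∂ b_j = 0`. -/
def TriDGA.stab {ρ : ℕ} (A : TriDGA.{u} ρ) (J : Type u) (hJ : Finite J) (c : J → ZMod ρ) :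
    TriDGA.{u} ρ :=
  TriDGA.ofGen (StabGen A.G J) (by have := A.finite; infer_instance)
    (Sum.elim A.deg (Sum.elim c (fun j => c j - 1)))
    (Sum.elim (fun x => rename Sum.inl (A.d (gen x)))
      (Sum.elim (fun j => gen (Sum.inr (Sum.inr j))) (fun _ => 0)))
    (by
      rintro (x | j | j)
      · exact map_mem_homog (deg := A.deg) (rename Sum.inl)
          (fun y => by
            rw [rename_gen]
            exact gen_mem_homog (Sum.elim A.deg (Sum.elim c (fun j => c j - 1))) (Sum.inl y))
          (A.d_homog _ _ (gen_mem_homog _ x))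
      · exact gen_mem_homog (Sum.elim A.deg (Sum.elim c (fun j => c j - 1))) (Sum.inr (Sum.inr j))
      · exact zero_mem _)
    (by
      rintro (x | j | j)
      · set δ : StabGen A.G J → Free (StabGen A.G J) :=
          (Sum.elim (fun x => rename Sum.inl (A.d (gen x)))
            (Sum.elim (fun j => gen (Sum.inr (Sum.inr j))) (fun _ => 0))) with hδ
        have key : ∀ p, rename Sum.inl (A.d p) = der δ (rename Sum.inl p) := by
          refine derivation_ext (rename Sum.inl) (rename Sum.inl)
            ((rename Sum.inl).toLinearMap ∘ₗ A.d) (der δ ∘ₗ (rename Sum.inl).toLinearMap) ?_ ?_ ?_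
          · intro p q; simp [A.d_mul]
          · intro p q; simp [der_mul]
          · intro x; simp [der_gen, hδ]
        change der δ (rename Sum.inl (A.d (gen x))) = 0
        rw [← key, A.d_d, map_zero]
      · change der _ (gen _) = 0
        rw [der_gen]; rfl
      · exact map_zero _)
    (by
      obtain ⟨r, hr, ht⟩ := A.triangular
      obtain ⟨n, ⟨e⟩⟩ := Finite.exists_equiv_fin J
      have hA := A.finite
      obtain ⟨N, hN⟩ : ∃ N, ∀ x, r x < N := by
        obtain ⟨N, hN⟩ := (Set.finite_range r).bddAbove
        exact ⟨N + 1, fun x => Nat.lt_succ_of_le (hN ⟨x, rfl⟩)⟩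
      refine ⟨Sum.elim r (Sum.elim (fun j => N + n + (e j : ℕ)) (fun j => N + (e j : ℕ))), ?_, ?_⟩
      · rintro (x | j | j) (y | k | k) h <;> simp only [Sum.elim_inl, Sum.elim_inr] at h
        · rw [hr h]
        · have := hN x; omega
        · have := hN x; omega
        · have := hN y; omega
        · have : e j = e k := Fin.ext (by omega)
          rw [e.injective this]
        · have := (e k).2; omega
        · have := hN y; omega
        · have := (e j).2; omega
        · have : e j = e k := Fin.ext (by omega)
          rw [e.injective this]
      · rintro (x | j | j)
        · have h := ht x
          have : (subalg {y | r y < r x}).map (rename Sum.inl) ≤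
              subalg {y | Sum.elim r (Sum.elim (fun j => N + n + (e j : ℕ))
                (fun j => N + (e j : ℕ))) y < r x} := by
            unfold subalg
            rw [AlgHom.map_adjoin]
            refine Algebra.adjoin_mono ?_
            rintro _ ⟨_, ⟨y, hy, rfl⟩, rfl⟩
            exact ⟨Sum.inl y, hy, (rename_gen _ _).symm⟩
          exact this ⟨_, h, rfl⟩
        · refine Algebra.subset_adjoin ⟨Sum.inr (Sum.inr j), ?_, rfl⟩
          have := (e j).2
          simp only [Set.mem_ofPred_eq, Sum.elim_inr, Sum.elim_inl]
          omega
        · exact zero_mem _)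

/-- The inclusion of a DGA into its stabilization. -/
def TriDGA.toStab {ρ : ℕ} (A : TriDGA.{u} ρ) (J : Type u) (hJ : Finite J) (c : J → ZMod ρ) :
    Hom A (A.stab J hJ c) :=
  Hom.ofGen (rename (Sum.inl : A.G → StabGen A.G J))
    (fun x => by
      have h := rename_gen (Sum.inl : A.G → StabGen A.G J) x
      refine (congrArg (fun p => p ∈ homog (A.stab J hJ c).deg (A.deg x)) h).mpr ?_
      exact gen_mem_homog (A.stab J hJ c).deg (Sum.inl x : StabGen A.G J))
    (fun x => by
      have h := rename_gen (Sum.inl : A.G → StabGen A.G J) x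
      refine Eq.trans ?_ (congrArg (A.stab J hJ c).d h).symm
      change _ = der _ (gen (Sum.inl x : StabGen A.G J))
      rw [der_gen]
      rfl)

/-- Tame isomorphisms of graded free algebras: compositions of degree-preserving relabellings of
the generators and elementary automorphisms, which send one generator `x` to `x + w`, with `w`
homogeneous of degree `|x|` in the subalgebra generated by the other generators, and fix all
other generators. -/
inductive IsTame {ρ : ℕ} : ∀ {G H : Type u}, (G → ZMod ρ) → (H → ZMod ρ) →
    (Free G ≃ₐ[ZMod 2] Free H) → Prop
  | relabel {G H : Type u} (deg : G → ZMod ρ) (deg' : H → ZMod ρ) (σ : G ≃ H)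
      (hσ : ∀ x, deg' (σ x) = deg x) (φ : Free G ≃ₐ[ZMod 2] Free H)
      (hφ : ∀ x, φ (gen x) = gen (σ x)) : IsTame deg deg' φ
  | elementary {G : Type u} (deg : G → ZMod ρ) (x : G) (w : Free G)
      (hw : w ∈ homog deg (deg x)) (hw' : w ∈ subalg {y | y ≠ x})
      (φ : Free G ≃ₐ[ZMod 2] Free G) (hx : φ (gen x) = gen x + w)
      (hy : ∀ y, y ≠ x → φ (gen y) = gen y) : IsTame deg deg φ
  | trans {G H L : Type u} {deg : G → ZMod ρ} {deg' : H → ZMod ρ} {deg'' : L → ZMod ρ}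
      {φ : Free G ≃ₐ[ZMod 2] Free H} {ψ : Free H ≃ₐ[ZMod 2] Free L}
      (hφ : IsTame deg deg' φ) (hψ : IsTame deg' deg'' ψ) : IsTame deg deg'' (φ.trans ψ)

/-- A DGA morphism that is a tame isomorphism. -/
def Hom.IsTameIso {ρ : ℕ} {A B : TriDGA.{u} ρ} (φ : Hom A B) : Prop :=
  ∃ e : Free A.G ≃ₐ[ZMod 2] Free B.G, IsTame A.deg B.deg e ∧ φ.toAlgHom = (e : _ →ₐ[ZMod 2] _)

/-! ### Immersed DGA maps -/

/-- An immersed DGA map `A₁ → B ↩ A₂`, the inclusion being induced by an injection `incl` of the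
generating set of `A₂` into that of `B`. -/
structure ImmersedMap {ρ : ℕ} (A₁ A₂ : TriDGA.{u} ρ) where
  B : TriDGA.{u} ρ
  f : Hom A₁ B
  incl : A₂.G ↪ B.G
  deg_incl : ∀ x, B.deg (incl x) = A₂.deg x
  d_incl : ∀ x, B.d (gen (incl x)) = rename incl (A₂.d (gen x))

/-- The DGA inclusion `i : A₂ → B` of an immersed DGA map. -/
def ImmersedMap.i {ρ : ℕ} {A₁ A₂ : TriDGA.{u} ρ} (M : ImmersedMap A₁ A₂) : Hom A₂ M.B :=
  Hom.ofGen (rename M.incl)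
    (fun x => by
      rw [rename_gen, ← M.deg_incl]
      exact gen_mem_homog _ _)
    (fun x => by rw [rename_gen, M.d_incl])

/-- The identity immersed map `A → A ↩ A`. -/
def ImmersedMap.id {ρ : ℕ} (A : TriDGA.{u} ρ) : ImmersedMap A A where
  B := A
  f := Hom.id A
  incl := Function.Embedding.refl _
  deg_incl _ := rfl
  d_incl x := by
    have : rename (Function.Embedding.refl A.G) = AlgHom.id (ZMod 2) (Free A.G) := by
      ext y; simp [rename, gen]
    rw [this]; rfl

/-- Immersed homotopy of immersed DGA maps: there is a stable tame isomorphism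
`φ : B * S → B' * S'` with `φ ∘ i = i'` and `φ ∘ f ≃ f'`. -/
def ImmersedHomotopic {ρ : ℕ} {A₁ A₂ : TriDGA.{u} ρ} (M M' : ImmersedMap A₁ A₂) : Prop :=
  ∃ (J J' : Type u) (hJ : Finite J) (hJ' : Finite J') (c : J → ZMod ρ) (c' : J' → ZMod ρ)
    (φ : Hom (M.B.stab J hJ c) (M'.B.stab J' hJ' c')),
    φ.IsTameIso ∧
    φ.comp ((M.B.toStab J hJ c).comp M.i) = (M'.B.toStab J' hJ' c').comp M'.i ∧
    Homotopic (φ.comp ((M.B.toStab J hJ c).comp M.f)) ((M'.B.toStab J' hJ' c').comp M'.f)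

/-! ### Composition of immersed DGA maps -/

section Pushout

variable {ρ : ℕ} {A₁ A₂ A₃ : TriDGA.{u} ρ} (M₂ : ImmersedMap A₂ A₃) (M₁ : ImmersedMap A₁ A₂)

/-- The generators of the push-out: those of `B₁` that do not come from `A₂`, and those of `B₂`. -/
abbrev PushGen : Type u := {b : M₁.B.G // b ∉ Set.range M₁.incl} ⊕ M₂.B.G

/-- The degrees of the generators of the push-out. -/
def pushDeg : PushGen M₂ M₁ → ZMod ρ := Sum.elim (fun b => M₁.B.deg b.1) M₂.B.deg

/-- The map `p₂` from `B₂` to the push-out, the identity on generators. -/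
def pushInr : Free M₂.B.G →ₐ[ZMod 2] Free (PushGen M₂ M₁) := rename Sum.inr

open Classical in
/-- The map `p₁` from `B₁` to the push-out: it replaces each generator `i₁ a` that comes from `A₂`
by `f₂ a`, and fixes the others. -/
noncomputable def pushInl : Free M₁.B.G →ₐ[ZMod 2] Free (PushGen M₂ M₁) :=
  FreeAlgebra.lift (ZMod 2) (fun b =>
    if h : b ∈ Set.range M₁.incl then pushInr M₂ M₁ (M₂.f.toAlgHom (gen h.choose))
    else gen (Sum.inl ⟨b, h⟩))

/-- The differential of the push-out on generators. -/
noncomputable def pushδ : PushGen M₂ M₁ → Free (PushGen M₂ M₁) :=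
  Sum.elim (fun b => pushInl M₂ M₁ (M₁.B.d (gen b.1)))
    (fun c => pushInr M₂ M₁ (M₂.B.d (gen c)))

theorem pushInl_incl (a : A₂.G) :
    pushInl M₂ M₁ (gen (M₁.incl a)) = pushInr M₂ M₁ (M₂.f.toAlgHom (gen a)) := by
  have h : M₁.incl a ∈ Set.range M₁.incl := ⟨a, rfl⟩
  have : h.choose = a := M₁.incl.injective h.choose_spec
  simp only [pushInl, gen, FreeAlgebra.lift_ι_apply, dif_pos h]
  rw [this]

theorem pushInl_new (b : M₁.B.G) (h : b ∉ Set.range M₁.incl) :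
    pushInl M₂ M₁ (gen b) = gen (Sum.inl ⟨b, h⟩) := by
  simp only [pushInl, gen, FreeAlgebra.lift_ι_apply, dif_neg h]

theorem pushInr_gen (c : M₂.B.G) : pushInr M₂ M₁ (gen c) = gen (Sum.inr c) := rename_gen _ _

/-- The push-out square commutes: `p₁ ∘ i₁ = p₂ ∘ f₂`. -/
theorem push_square (p : Free A₂.G) :
    pushInl M₂ M₁ (M₁.i.toAlgHom p) = pushInr M₂ M₁ (M₂.f.toAlgHom p) := by
  have : (pushInl M₂ M₁).comp M₁.i.toAlgHom = (pushInr M₂ M₁).comp M₂.f.toAlgHom := by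
    apply FreeAlgebra.hom_ext
    funext a
    change pushInl M₂ M₁ (rename M₁.incl (gen a)) = _
    rw [rename_gen]
    exact pushInl_incl M₂ M₁ a
  exact DFunLike.congr_fun this p

/-- The universal property of the push-out. -/
theorem push_desc {R : Type v} [Ring R] [Algebra (ZMod 2) R]
    (g₁ : Free M₁.B.G →ₐ[ZMod 2] R) (g₂ : Free M₂.B.G →ₐ[ZMod 2] R)
    (h : g₁.comp M₁.i.toAlgHom = g₂.comp M₂.f.toAlgHom) :
    ∃! g : Free (PushGen M₂ M₁) →ₐ[ZMod 2] R,
      g.comp (pushInl M₂ M₁) = g₁ ∧ g.comp (pushInr M₂ M₁) = g₂ := by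
  set g : Free (PushGen M₂ M₁) →ₐ[ZMod 2] R := FreeAlgebra.lift (ZMod 2)
    (Sum.elim (fun b => g₁ (gen b.1)) (fun c => g₂ (gen c))) with hg
  have hr : g.comp (pushInr M₂ M₁) = g₂ := by
    apply FreeAlgebra.hom_ext
    funext c
    change g (pushInr M₂ M₁ (gen c)) = g₂ (gen c)
    rw [pushInr_gen]; simp [hg, gen]
  refine ⟨g, ⟨?_, hr⟩, ?_⟩
  · apply FreeAlgebra.hom_ext
    funext b
    change g (pushInl M₂ M₁ (gen b)) = g₁ (gen b)
    by_cases hb : b ∈ Set.range M₁.incl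
    · obtain ⟨a, rfl⟩ := hb
      rw [pushInl_incl]
      have h1 := DFunLike.congr_fun hr (M₂.f.toAlgHom (gen a))
      have h2 := DFunLike.congr_fun h (gen a)
      change g₁ (rename M₁.incl (gen a)) = g₂ (M₂.f.toAlgHom (gen a)) at h2
      rw [rename_gen] at h2
      exact h1.trans h2.symm
    · rw [pushInl_new M₂ M₁ b hb]; simp [hg, gen]
  · rintro g' ⟨h1, h2⟩
    apply FreeAlgebra.hom_ext
    funext x
    rcases x with b | c
    · have := DFunLike.congr_fun h1 (gen b.1)
      change g' (pushInl M₂ M₁ (gen b.1)) = _ at this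
      rw [pushInl_new M₂ M₁ b.1 b.2] at this
      change g' (gen (Sum.inl b)) = g (gen (Sum.inl b))
      rw [this]; simp [hg, gen]
    · have := DFunLike.congr_fun h2 (gen c)
      change g' (pushInr M₂ M₁ (gen c)) = _ at this
      rw [pushInr_gen] at this
      change g' (gen (Sum.inr c)) = g (gen (Sum.inr c))
      rw [this]; simp [hg, gen]

theorem pushInr_d (p : Free M₂.B.G) :
    pushInr M₂ M₁ (M₂.B.d p) = der (pushδ M₂ M₁) (pushInr M₂ M₁ p) := by
  refine derivation_ext (pushInr M₂ M₁) (pushInr M₂ M₁)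
    ((pushInr M₂ M₁).toLinearMap ∘ₗ M₂.B.d)
    (der (pushδ M₂ M₁) ∘ₗ (pushInr M₂ M₁).toLinearMap) ?_ ?_ ?_ p
  · intro p q; simp [M₂.B.d_mul]
  · intro p q; simp [der_mul]
  · intro c
    change pushInr M₂ M₁ (M₂.B.d (gen c)) = der (pushδ M₂ M₁) (pushInr M₂ M₁ (gen c))
    rw [pushInr_gen, der_gen]; rfl

theorem pushInl_d (p : Free M₁.B.G) :
    pushInl M₂ M₁ (M₁.B.d p) = der (pushδ M₂ M₁) (pushInl M₂ M₁ p) := by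
  refine derivation_ext (pushInl M₂ M₁) (pushInl M₂ M₁)
    ((pushInl M₂ M₁).toLinearMap ∘ₗ M₁.B.d)
    (der (pushδ M₂ M₁) ∘ₗ (pushInl M₂ M₁).toLinearMap) ?_ ?_ ?_ p
  · intro p q; simp [M₁.B.d_mul]
  · intro p q; simp [der_mul]
  · intro b
    change pushInl M₂ M₁ (M₁.B.d (gen b)) = der (pushδ M₂ M₁) (pushInl M₂ M₁ (gen b))
    by_cases hb : b ∈ Set.range M₁.incl
    · obtain ⟨a, rfl⟩ := hb
      rw [M₁.d_incl, pushInl_incl, ← pushInr_d, ← M₂.f.map_d]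
      exact push_square M₂ M₁ _
    · rw [pushInl_new M₂ M₁ b hb, der_gen]; rfl

theorem pushInr_homog (k : ZMod ρ) (p : Free M₂.B.G) (hp : p ∈ homog M₂.B.deg k) :
    pushInr M₂ M₁ p ∈ homog (pushDeg M₂ M₁) k :=
  map_mem_homog (pushInr M₂ M₁)
    (fun c => by
      rw [pushInr_gen]
      exact gen_mem_homog (pushDeg M₂ M₁) (Sum.inr c)) hp

theorem pushInl_homog (k : ZMod ρ) (p : Free M₁.B.G) (hp : p ∈ homog M₁.B.deg k) :
    pushInl M₂ M₁ p ∈ homog (pushDeg M₂ M₁) k := by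
  refine map_mem_homog (pushInl M₂ M₁) (fun b => ?_) hp
  by_cases hb : b ∈ Set.range M₁.incl
  · obtain ⟨a, rfl⟩ := hb
    rw [pushInl_incl, M₁.deg_incl]
    exact pushInr_homog _ _ _ _ (M₂.f.map_homog _ _ (gen_mem_homog _ a))
  · rw [pushInl_new M₂ M₁ b hb]
    exact gen_mem_homog (pushDeg M₂ M₁) (Sum.inl ⟨b, hb⟩)

theorem push_triangular : ∃ r : PushGen M₂ M₁ → ℕ, Function.Injective r ∧
    ∀ x, pushδ M₂ M₁ x ∈ subalg {y | r y < r x} := by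
  obtain ⟨r₁, hr₁, ht₁⟩ := M₁.B.triangular
  obtain ⟨r₂, hr₂, ht₂⟩ := M₂.B.triangular
  have h2 := M₂.B.finite
  obtain ⟨N, hN⟩ : ∃ N, ∀ x, r₂ x < N := by
    obtain ⟨N, hN⟩ := (Set.finite_range r₂).bddAbove
    exact ⟨N + 1, fun x => Nat.lt_succ_of_le (hN ⟨x, rfl⟩)⟩
  have hmap : ∀ (Y : Set (PushGen M₂ M₁)), (∀ c, Sum.inr c ∈ Y) → ∀ p,
      pushInr M₂ M₁ p ∈ subalg Y := by
    intro Y hY p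
    induction p using FreeAlgebra.induction with
    | grade0 r => simp
    | grade1 c =>
      have := pushInr_gen M₂ M₁ c
      unfold gen at this
      rw [this]
      exact Algebra.subset_adjoin ⟨_, hY c, rfl⟩
    | mul p q hp hq => rw [map_mul]; exact mul_mem hp hq
    | add p q hp hq => rw [map_add]; exact add_mem hp hq
  refine ⟨Sum.elim (fun b => N + r₁ b.1) r₂, ?_, ?_⟩
  · rintro (b | c) (b' | c') h <;> simp only [Sum.elim_inl, Sum.elim_inr] at h
    · rw [Subtype.ext (hr₁ (by omega : r₁ b.1 = r₁ b'.1))]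
    · have := hN c'; omega
    · have := hN c; omega
    · rw [hr₂ h]
  · rintro (b | c)
    · have : (subalg {y | r₁ y < r₁ b.1}).map (pushInl M₂ M₁) ≤
          subalg {y | Sum.elim (fun b => N + r₁ b.1) r₂ y <
            (Sum.elim (fun b => N + r₁ b.1) r₂ (Sum.inl b : PushGen M₂ M₁))} := by
        conv_lhs => unfold subalg
        rw [AlgHom.map_adjoin]
        refine Algebra.adjoin_le ?_
        rintro _ ⟨_, ⟨y, hy, rfl⟩, rfl⟩
        simp only [SetLike.mem_coe]
        by_cases hb : y ∈ Set.range M₁.incl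
        · obtain ⟨a, rfl⟩ := hb
          rw [pushInl_incl]
          refine hmap _ (fun c => ?_) _
          have := hN c
          simp only [Set.mem_ofPred_eq, Sum.elim_inr, Sum.elim_inl]
          omega
        · rw [pushInl_new M₂ M₁ y hb]
          refine Algebra.subset_adjoin ⟨_, ?_, rfl⟩
          simp only [Set.mem_ofPred_eq, Sum.elim_inl] at hy ⊢
          omega
      exact this ⟨_, ht₁ b.1, rfl⟩
    · have : (subalg {y | r₂ y < r₂ c}).map (pushInr M₂ M₁) ≤
          subalg {y | Sum.elim (fun b => N + r₁ b.1) r₂ y <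
            (Sum.elim (fun b => N + r₁ b.1) r₂ (Sum.inr c : PushGen M₂ M₁))} := by
        unfold subalg
        rw [AlgHom.map_adjoin]
        refine Algebra.adjoin_mono ?_
        rintro _ ⟨_, ⟨y, hy, rfl⟩, rfl⟩
        exact ⟨Sum.inr y, hy, (pushInr_gen _ _ _).symm⟩
      exact this ⟨_, ht₂ c, rfl⟩

/-- The push-out of `i₁ : A₂ → B₁` and `f₂ : A₂ → B₂` as a triangular DGA. -/
noncomputable def pushout : TriDGA.{u} ρ :=
  TriDGA.ofGen (PushGen M₂ M₁)
    (by have := M₁.B.finite; have := M₂.B.finite; infer_instance)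
    (pushDeg M₂ M₁) (pushδ M₂ M₁)
    (by
      rintro (b | c)
      · exact pushInl_homog _ _ _ _ (M₁.B.d_homog _ _ (gen_mem_homog _ b.1))
      · exact pushInr_homog _ _ _ _ (M₂.B.d_homog _ _ (gen_mem_homog _ c)))
    (by
      rintro (b | c)
      · change der (pushδ M₂ M₁) (pushInl M₂ M₁ (M₁.B.d (gen b.1))) = 0
        rw [← pushInl_d, M₁.B.d_d, map_zero]
      · change der (pushδ M₂ M₁) (pushInr M₂ M₁ (M₂.B.d (gen c))) = 0
        rw [← pushInr_d, M₂.B.d_d, map_zero])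
    (push_triangular M₂ M₁)

/-- `p₁ : B₁ → B` as a DGA morphism. -/
noncomputable def pushHom₁ : Hom M₁.B (pushout M₂ M₁) where
  toAlgHom := pushInl M₂ M₁
  map_homog := pushInl_homog M₂ M₁
  map_d := pushInl_d M₂ M₁

/-- `M₂.comp M₁` is the composition `M₂ ∘ M₁ = (A₁ → B ↩ A₃)`, where `B` is the push-out,
`f = p₁ ∘ f₁` and `i = p₂ ∘ i₂`. -/
noncomputable def ImmersedMap.comp : ImmersedMap A₁ A₃ where
  B := pushout M₂ M₁
  f := (pushHom₁ M₂ M₁).comp M₁.f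
  incl := M₂.incl.trans ⟨Sum.inr, Sum.inr_injective⟩
  deg_incl x := M₂.deg_incl x
  d_incl x := by
    change der (pushδ M₂ M₁) (gen (Sum.inr (M₂.incl x))) = _
    rw [der_gen]
    change pushInr M₂ M₁ (M₂.B.d (gen (M₂.incl x))) = _
    rw [M₂.d_incl]
    have : (pushInr M₂ M₁).comp (rename M₂.incl) =
        rename (M₂.incl.trans ⟨Sum.inr, Sum.inr_injective⟩ : A₃.G ↪ PushGen M₂ M₁) := by
      apply FreeAlgebra.hom_ext
      funext y
      change pushInr M₂ M₁ (rename M₂.incl (gen y)) = rename _ (gen y)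
      rw [rename_gen, rename_gen, pushInr_gen]; rfl
    exact DFunLike.congr_fun this _

end Pushout

/-! ### The category of triangular DGAs and immersed homotopy classes of immersed maps -/

/-- Immersed homotopy classes of immersed DGA maps. -/
def ImHom {ρ : ℕ} (A₁ A₂ : TriDGA.{u} ρ) : Type (u + 1) :=
  Quot (ImmersedHomotopic (A₁ := A₁) (A₂ := A₂))

/-- The class `[M]` of an immersed DGA map. -/
def ImmersedMap.cls {ρ : ℕ} {A₁ A₂ : TriDGA.{u} ρ} (M : ImmersedMap A₁ A₂) : ImHom A₁ A₂ :=
  Quot.mk _ M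

/-- Composition of immersed DGA maps descends to immersed homotopy classes, where it is unital and
associative. -/
structure IsCategory (ρ : ℕ) : Prop where
  comp_congr : ∀ {A₁ A₂ A₃ : TriDGA.{u} ρ} (M₂ M₂' : ImmersedMap A₂ A₃)
    (M₁ M₁' : ImmersedMap A₁ A₂), M₂.cls = M₂'.cls → M₁.cls = M₁'.cls →
    (M₂.comp M₁).cls = (M₂'.comp M₁').cls
  comp_id : ∀ {A₁ A₂ : TriDGA.{u} ρ} (M : ImmersedMap A₁ A₂),
    (M.comp (ImmersedMap.id A₁)).cls = M.cls
  id_comp : ∀ {A₁ A₂ : TriDGA.{u} ρ} (M : ImmersedMap A₁ A₂),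
    ((ImmersedMap.id A₂).comp M).cls = M.cls
  assoc : ∀ {A₁ A₂ A₃ A₄ : TriDGA.{u} ρ} (M₃ : ImmersedMap A₃ A₄) (M₂ : ImmersedMap A₂ A₃)
    (M₁ : ImmersedMap A₁ A₂),
    ((M₃.comp M₂).comp M₁).cls = (M₃.comp (M₂.comp M₁)).cls

/-- The type of objects of the category of triangular DGAs and immersed maps. -/
abbrev DGAim (ρ : ℕ) : Type (u + 1) := TriDGA.{u} ρ

/-- The category whose objects are the triangular DGAs graded by `ℤ/ρ`, whose morphisms are the
immersed homotopy classes of immersed DGA maps, with `[M₂] ∘ [M₁] = [M₂ ∘ M₁]` (in the diagrammatic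
notation of Mathlib, `[M₁] ≫ [M₂]`) and identities `[A → A ↩ A]`. -/
@[reducible] noncomputable def IsCategory.category {ρ : ℕ} (h : IsCategory.{u} ρ) :
    Category.{u + 1} (DGAim.{u} ρ) where
  Hom A₁ A₂ := ImHom A₁ A₂
  id A := (ImmersedMap.id A).cls
  comp {A₁ A₂ A₃} m₁ m₂ := Quot.lift
    (fun M₁ : ImmersedMap A₁ A₂ => Quot.lift
      (fun M₂ : ImmersedMap A₂ A₃ => (M₂.comp M₁).cls)
      (fun M₂ M₂' hM => h.comp_congr M₂ M₂' M₁ M₁ (Quot.sound hM) rfl) m₂)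
    (fun M₁ M₁' hM => by
      induction m₂ using Quot.ind with
      | mk M₂ => exact h.comp_congr M₂ M₂ M₁ M₁' rfl (Quot.sound hM)) m₁
  id_comp m := by
    induction m using Quot.ind with
    | mk M => exact h.comp_id M
  comp_id m := by
    induction m using Quot.ind with
    | mk M => exact h.id_comp M
  assoc m₁ m₂ m₃ := by
    induction m₁ using Quot.ind with
    | mk M₁ =>
      induction m₂ using Quot.ind with
      | mk M₂ =>
        induction m₃ using Quot.ind with
        | mk M₃ => exact (h.assoc M₃ M₂ M₁).symm

/-! ### Augmentations and induced augmentation sets -/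

/-- A `ρ`-graded augmentation to `ℤ/2`, i.e. a DGA morphism to `ℤ/2` (in degree `0`, with zero
differential). -/
@[ext] structure Aug {ρ : ℕ} (A : TriDGA.{u} ρ) where
  toAlgHom : Free A.G →ₐ[ZMod 2] ZMod 2
  map_homog : ∀ k, ∀ p ∈ homog A.deg k, toAlgHom p ≠ 0 → k = 0
  map_d : ∀ p, toAlgHom (A.d p) = 0

/-- DGA homotopy of augmentations: there is an `(ε, ε')`-derivation `K : A → ℤ/2` of degree `1`
with `ε - ε' = K ∂` (the differential of `ℤ/2` is zero). -/
def AugHomotopic {ρ : ℕ} {A : TriDGA.{u} ρ} (ε ε' : Aug A) : Prop :=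
  ∃ K : Free A.G →ₗ[ZMod 2] ZMod 2,
    (∀ k, ∀ p ∈ homog A.deg k, K p ≠ 0 → k + 1 = 0) ∧
    (∀ p q, K (p * q) = K p * ε'.toAlgHom q + ε.toAlgHom p * K q) ∧
    ∀ p, ε.toAlgHom p - ε'.toAlgHom p = K (A.d p)

/-- The set `Aug(A)/∼` of DGA homotopy classes of augmentations. -/
def AugClass {ρ : ℕ} (A : TriDGA.{u} ρ) : Type u := Quot (AugHomotopic (A := A))

/-- The pullback `f^* ε = ε ∘ f`. -/
def Aug.pullback {ρ : ℕ} {A B : TriDGA.{u} ρ} (f : Hom A B) (ε : Aug B) : Aug A where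
  toAlgHom := ε.toAlgHom.comp f.toAlgHom
  map_homog k p hp := ε.map_homog k _ (f.map_homog k p hp)
  map_d p := by simp [f.map_d, ε.map_d]

/-- The pullback `f^*` on homotopy classes. -/
def AugClass.pullback {ρ : ℕ} {A B : TriDGA.{u} ρ} (f : Hom A B) : AugClass B → AugClass A :=
  Quot.map (Aug.pullback f) (by
    rintro ε ε' ⟨K, h1, h2, h3⟩
    refine ⟨K ∘ₗ f.toAlgHom.toLinearMap, fun k p hp => h1 k _ (f.map_homog k p hp), ?_, ?_⟩
    · intro p q; simp [h2, Aug.pullback]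
    · intro p; simp [h3, Aug.pullback, f.map_d])

/-- The induced augmentation set `I(M) ⊆ Aug(A₂)/∼ × Aug(A₁)/∼` of an immersed DGA map from `A₁` to
`A₂`: the image of `i^* × f^*`. -/
def ImmersedMap.augSet {ρ : ℕ} {A₁ A₂ : TriDGA.{u} ρ} (M : ImmersedMap A₁ A₂) :
    SetRel (AugClass A₂) (AugClass A₁) :=
  Set.range (fun α : AugClass M.B => (AugClass.pullback M.i α, AugClass.pullback M.f α))

end ImmersedDGA

namespace ImmersedDGA

/-! ### Algebra maps out of a free algebra -/

section FreeAlgebraMaps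

variable {G H : Type u} {B : Type v} [Ring B] [Algebra (ZMod 2) B]

/-! Write `A₁ → B₁ ↩ A₂` and `A₂ → B₂ ↩ A₃` for the two factors of a composition, with maps `f₁, i₁`
and `f₂, i₂`. An immersed homotopy factors into three moves: stabilizing `B`, a tame isomorphism of
`B` strictly compatible with `f` and `i`, and a homotopy of `f`
(`ImmersedMap.eq_of_immersedHomotopic`). Every invariance claim is checked on these moves.

The main tool is the homotopy extension property of `A₂ ⊂ B₁` (`ImmersedMap.exists_extension_left`
and its mirror image). A homotopy on `A₂` extends to `B₁`: let `K` vanish on the new generators and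
solve `f - g = ∂K + K∂` for the missing map, recursively along the triangular order. The target is
an arbitrary graded differential algebra, so that push-outs and `ℤ/2` are both covered.

The unit and associativity laws and most of the moves only relabel the generators of a push-out or
extend a tame isomorphism by the identity. Two cases have real content. (1) Replacing `f₂` by a
homotopic `g` changes the differential of the push-out. Extension yields `u ≃ p₁` on `B₁` with `u i₁
= p₂ f₂`; the pair `(u, p₂)` is unitriangular on generators, hence a tame isomorphism of push-outs
(`cls_comp_congr_left_of_homotopic`). (2) A tame isomorphism `B₁ → B₁'` under `A₂` may factor
through elementary automorphisms that move the generators of `A₂`, so its factors cannot be pushed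
forward one at a time. A mapping cylinder replaces `f₂` by a map which, after a tame change of
coordinates, is an injection of generators (`exists_coordinates`). The push-out then simply adjoins
the remaining generators of `B₂` to `B₁`, and the isomorphism is extended by the identity on these
(`cls_comp_congr_right_of_coordinates`).

For functoriality, let augmentations `α₁` of `B₁` and `α₂` of `B₂` have homotopic restrictions to
`A₂`. Homotopy extension changes `α₁` within its class until the restrictions agree exactly, and the
universal property of the push-out glues the two (`ImmersedMap.augSet_comp`). -/

theorem add_self_eq_zero_of_algebra (a : B) : a + a = 0 := by
  rw [← two_smul (ZMod 2) a, (by decide : (2 : ZMod 2) = 0), zero_smul]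

theorem algHom_ext_gen {f g : Free G →ₐ[ZMod 2] B} (h : ∀ x, f (gen x) = g (gen x)) : f = g :=
  FreeAlgebra.hom_ext (funext h)

@[simp] theorem lift_gen (F : G → B) (x : G) : FreeAlgebra.lift (ZMod 2) F (gen x) = F x :=
  FreeAlgebra.lift_ι_apply _ _

theorem map_mem_of_mem_subalg {f : Free G →ₐ[ZMod 2] B} {Y : Set G} {S : Subalgebra (ZMod 2) B}
    (h : ∀ y ∈ Y, f (gen y) ∈ S) {p : Free G} (hp : p ∈ subalg Y) : f p ∈ S := by
  refine (?_ : subalg Y ≤ S.comap f) hp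
  refine Algebra.adjoin_le ?_
  rintro _ ⟨y, hy, rfl⟩
  exact h y hy

theorem eq_of_mem_subalg {f g : Free G →ₐ[ZMod 2] B} {Y : Set G}
    (h : ∀ y ∈ Y, f (gen y) = g (gen y)) {p : Free G} (hp : p ∈ subalg Y) : f p = g p := by
  refine (?_ : subalg Y ≤ AlgHom.equalizer f g) hp
  refine Algebra.adjoin_le ?_
  rintro _ ⟨y, hy, rfl⟩
  exact h y hy

theorem gen_mem_subalg {Y : Set G} {y : G} (hy : y ∈ Y) : gen y ∈ subalg Y :=
  Algebra.subset_adjoin ⟨y, hy, rfl⟩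

theorem subalg_mono {Y Z : Set G} (h : ∀ y ∈ Y, y ∈ Z) {p : Free G} (hp : p ∈ subalg Y) :
    p ∈ subalg Z := by
  have : subalg Y ≤ subalg Z := Algebra.adjoin_mono (Set.image_mono h)
  exact this hp

theorem mem_subalg_univ (p : Free G) : p ∈ subalg (Set.univ : Set G) := by
  have : AlgHom.id (ZMod 2) (Free G) = (Subalgebra.val _).comp
      (FreeAlgebra.lift (ZMod 2) (fun x => (⟨gen x, gen_mem_subalg (Set.mem_univ x)⟩ :
        subalg (Set.univ : Set G)))) := algHom_ext_gen (fun x => by simp)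
  have h := DFunLike.congr_fun this p
  rw [AlgHom.id_apply] at h
  rw [h]
  exact Subtype.prop _

theorem rename_mem_subalg {e : G → H} {Y : Set H} (h : ∀ x, e x ∈ Y) (p : Free G) :
    rename e p ∈ subalg Y :=
  map_mem_of_mem_subalg (Y := Set.univ)
    (fun y _ => by rw [rename_gen]; exact gen_mem_subalg (h y)) (mem_subalg_univ p)

theorem rename_mem_homog {ρ : ℕ} {deg : G → ZMod ρ} {deg' : H → ZMod ρ} {e : G → H}
    (h : ∀ x, deg' (e x) = deg x) {k : ZMod ρ} {p : Free G} (hp : p ∈ homog deg k) :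
    rename e p ∈ homog deg' k :=
  map_mem_homog _ (fun x => by rw [rename_gen, ← h]; exact gen_mem_homog _ _) hp

theorem rename_comp {L : Type w} (e : G → H) (e' : H → L) :
    (rename e').comp (rename e) = rename (e' ∘ e) :=
  algHom_ext_gen (fun x => by simp)

theorem rename_rename {L : Type w} (e : G → H) (e' : H → L) (p : Free G) :
    rename e' (rename e p) = rename (e' ∘ e) p :=
  DFunLike.congr_fun (rename_comp e e') p

theorem rename_id : rename (id : G → G) = AlgHom.id (ZMod 2) (Free G) :=
  algHom_ext_gen (fun x => by simp)

/-- The isomorphism of free algebras given by a bijection of generators. -/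
def relabelEquiv (σ : G ≃ H) : Free G ≃ₐ[ZMod 2] Free H :=
  AlgEquiv.ofAlgHom (rename σ) (rename σ.symm)
    (by rw [rename_comp, Equiv.self_comp_symm, rename_id])
    (by rw [rename_comp, Equiv.symm_comp_self, rename_id])

@[simp] theorem relabelEquiv_apply (σ : G ≃ H) (p : Free G) : relabelEquiv σ p = rename σ p := rfl

/-- Since `w` does not involve `x`, it is fixed by the substitution, which in characteristic 2 is
therefore its own inverse. -/
theorem exists_elementary (x : G) {w : Free G} (hw : w ∈ subalg {y | y ≠ x}) :
    ∃ φ : Free G ≃ₐ[ZMod 2] Free G,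
      φ (gen x) = gen x + w ∧ ∀ y, y ≠ x → φ (gen y) = gen y := by
  classical
  set f : Free G →ₐ[ZMod 2] Free G :=
    FreeAlgebra.lift (ZMod 2) (Function.update gen x (gen x + w)) with hf
  have hx : f (gen x) = gen x + w := by simp [hf]
  have hy : ∀ y, y ≠ x → f (gen y) = gen y := fun y h => by simp [hf, h]
  have hw' : f w = w := eq_of_mem_subalg (g := AlgHom.id _ _) hy hw
  have hff : f.comp f = AlgHom.id _ _ := algHom_ext_gen (fun y => by
    by_cases h : y = x
    · subst h
      simp only [AlgHom.comp_apply, hx, map_add, hw', AlgHom.id_apply]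
      rw [add_assoc, add_self_eq_zero_of_algebra, add_zero]
    · simp [hy y h])
  exact ⟨AlgEquiv.ofAlgHom f f hff hff, hx, hy⟩

end FreeAlgebraMaps

/-! ### Tame isomorphisms -/

section Tame

variable {ρ : ℕ} {G H : Type u} {deg : G → ZMod ρ} {deg' : H → ZMod ρ}

theorem IsTame.relabelEquiv (σ : G ≃ H) (hσ : ∀ x, deg' (σ x) = deg x) :
    IsTame deg deg' (relabelEquiv σ) :=
  .relabel deg deg' σ hσ _ (fun x => by simp)

theorem IsTame.refl (deg : G → ZMod ρ) : IsTame deg deg AlgEquiv.refl :=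
  .relabel deg deg (Equiv.refl G) (fun _ => rfl) _ (fun _ => rfl)

theorem IsTame.symm {φ : Free G ≃ₐ[ZMod 2] Free H} (h : IsTame deg deg' φ) :
    IsTame deg' deg φ.symm := by
  induction h with
  | relabel deg deg' σ hσ φ hφ =>
    refine .relabel deg' deg σ.symm (fun x => by rw [← hσ]; simp) _ (fun x => ?_)
    rw [AlgEquiv.symm_apply_eq, hφ]; simp
  | elementary deg x w hw hw' φ hx hy =>
    have hφw : φ w = w := eq_of_mem_subalg (f := φ.toAlgHom) (g := AlgHom.id _ _) hy hw'
    refine .elementary deg x w hw hw' _ ?_ (fun y h => ?_)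
    · rw [AlgEquiv.symm_apply_eq, map_add, hx, hφw, add_assoc, add_self_eq_zero_of_algebra,
        add_zero]
    · rw [AlgEquiv.symm_apply_eq, hy y h]
  | trans _ _ h1 h2 => exact .trans h2 h1

theorem IsTame.mem_homog {φ : Free G ≃ₐ[ZMod 2] Free H} (h : IsTame deg deg' φ) {k : ZMod ρ}
    {p : Free G} (hp : p ∈ homog deg k) : φ p ∈ homog deg' k := by
  induction h with
  | relabel deg deg' σ hσ φ hφ =>
    refine map_mem_homog φ.toAlgHom (fun x => ?_) hp
    rw [← hσ]
    exact (hφ x).symm ▸ gen_mem_homog _ _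
  | elementary deg x w hw hw' φ hx hy =>
    refine map_mem_homog φ.toAlgHom (fun y => ?_) hp
    by_cases h : y = x
    · subst h
      exact hx.symm ▸ add_mem (gen_mem_homog _ _) hw
    · exact (hy y h).symm ▸ gen_mem_homog _ _
  | trans _ _ h1 h2 => exact h2 (h1 hp)

/-- A tame isomorphism extended by the identity on further generators is tame. -/
theorem IsTame.exists_extend {φ : Free G ≃ₐ[ZMod 2] Free H} (h : IsTame deg deg' φ)
    {K : Type u} (degK : K → ZMod ρ) :
    ∃ Φ : Free (K ⊕ G) ≃ₐ[ZMod 2] Free (K ⊕ H),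
      IsTame (Sum.elim degK deg) (Sum.elim degK deg') Φ ∧
      (∀ p, Φ (rename Sum.inr p) = rename Sum.inr (φ p)) ∧
      ∀ y, Φ (gen (Sum.inl y)) = gen (Sum.inl y) := by
  have ext : ∀ {G H : Type u} (φ : Free G ≃ₐ[ZMod 2] Free H)
      (Φ : Free (K ⊕ G) ≃ₐ[ZMod 2] Free (K ⊕ H)),
      (∀ x, Φ (gen (Sum.inr x)) = rename Sum.inr (φ (gen x))) →
      ∀ p, Φ (rename Sum.inr p) = rename Sum.inr (φ p) := by
    intro G H φ Φ h p
    refine DFunLike.congr_fun (?_ : Φ.toAlgHom.comp (rename Sum.inr) =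
      (rename Sum.inr).comp φ.toAlgHom) p
    exact algHom_ext_gen (fun x => by simpa using h x)
  induction h with
  | relabel deg deg' σ hσ φ hφ =>
    refine ⟨ImmersedDGA.relabelEquiv (Equiv.sumCongr (Equiv.refl K) σ),
      .relabelEquiv _ ?_, ext _ _ (fun x => ?_), fun y => ?_⟩
    · rintro (y | x)
      · rfl
      · exact hσ x
    · rw [relabelEquiv_apply, rename_gen, hφ, rename_gen]; rfl
    · rw [relabelEquiv_apply, rename_gen]; rfl
  | @elementary G deg x w hw hw' φ hx hy =>
    have hw2 : rename Sum.inr w ∈ subalg {y : K ⊕ G | y ≠ Sum.inr x} :=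
      map_mem_of_mem_subalg (fun y h => by
        rw [rename_gen]
        exact gen_mem_subalg (fun h' => h (Sum.inr_injective h'))) hw'
    obtain ⟨Φ, h1, h2⟩ := exists_elementary (Sum.inr x : K ⊕ G) hw2
    have hw1 : rename Sum.inr w ∈ homog (Sum.elim degK deg) (deg x) :=
      rename_mem_homog (deg := deg) (e := Sum.inr) (fun _ => rfl) hw
    refine ⟨Φ, .elementary _ (Sum.inr x) (rename Sum.inr w) hw1 hw2 Φ h1 h2, ext _ _ ?_,
      fun y => h2 _ Sum.inl_ne_inr⟩
    intro y
    by_cases h : y = x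
    · subst h; rw [h1, hx, map_add, rename_gen]
    · rw [h2 _ (fun h' => h (Sum.inr_injective h')), hy y h, rename_gen]
  | trans _ _ h1 h2 =>
    obtain ⟨Φ, hΦ, h3, h4⟩ := h1
    obtain ⟨Ψ, hΨ, h5, h6⟩ := h2
    exact ⟨Φ.trans Ψ, hΦ.trans hΨ, fun p => by simp [h3, h5], fun y => by simp [h4, h6]⟩

/-- Triangular endomorphisms of a graded free algebra are tame automorphisms. -/
theorem exists_tame_triangular [Finite G] (deg : G → ZMod ρ) (w : G → Free G)
    (hw : ∀ x, w x ∈ homog deg (deg x)) (r : G → ℕ) (hr : Function.Injective r)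
    (ht : ∀ x, w x ∈ subalg {y | r y < r x}) :
    ∃ φ : Free G ≃ₐ[ZMod 2] Free G, IsTame deg deg φ ∧ ∀ x, φ (gen x) = gen x + w x := by
  -- Generators are corrected in order of rank. The elementary automorphism at the generator of rank
  -- `n` is applied last: it fixes every earlier `gen y + w y`, which involves only generators of
  -- rank less than `n`. Injectivity of `r` leaves at most one generator per rank.
  have key : ∀ n : ℕ, ∃ φ : Free G ≃ₐ[ZMod 2] Free G, IsTame deg deg φ ∧
      (∀ x, r x < n → φ (gen x) = gen x + w x) ∧ ∀ x, n ≤ r x → φ (gen x) = gen x := by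
    intro n
    induction n with
    | zero => exact ⟨AlgEquiv.refl, .refl deg, fun x h => absurd h (by omega), fun _ _ => rfl⟩
    | succ n ih =>
      obtain ⟨φ, hφ, h1, h2⟩ := ih
      by_cases hx : ∃ x, r x = n
      · obtain ⟨x, rfl⟩ := hx
        have hwx : w x ∈ subalg {y | y ≠ x} := by
          refine subalg_mono ?_ (ht x)
          rintro y hy rfl
          exact lt_irrefl _ (Set.mem_ofPred_eq ▸ hy)
        obtain ⟨ε, h3, h4⟩ := exists_elementary x hwx
        refine ⟨φ.trans ε, hφ.trans (.elementary _ x (w x) (hw x) hwx ε h3 h4), ?_, ?_⟩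
        · intro y hy
          rcases Nat.lt_succ_iff_lt_or_eq.1 hy with hy | hy
          · have h5 : ε (w y) = w y :=
              eq_of_mem_subalg (f := ε.toAlgHom) (g := AlgHom.id _ _)
                (fun z (hz : r z < r y) => h4 z (fun h => by subst h; omega)) (ht y)
            rw [AlgEquiv.trans_apply, h1 y hy, map_add, h5, h4 y (fun h => by subst h; omega)]
          · rw [hr hy, AlgEquiv.trans_apply, h2 x le_rfl, h3]
        · intro y hy
          rw [AlgEquiv.trans_apply, h2 y (by omega), h4 y (fun h => by subst h; omega)]
      · refine ⟨φ, hφ, fun y hy => h1 y ?_, fun y hy => h2 y (by omega)⟩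
        exact lt_of_le_of_ne (by omega) (fun h => hx ⟨y, h⟩)
  obtain ⟨N, hN⟩ := (Set.finite_range r).bddAbove
  obtain ⟨φ, hφ, h, -⟩ := key (N + 1)
  exact ⟨φ, hφ, fun x => h x (Nat.lt_succ_of_le (hN ⟨x, rfl⟩))⟩

end Tame

/-! ### DGA morphisms, homotopies and stabilizations -/

section Hom

variable {ρ : ℕ} {A B C D : TriDGA.{u} ρ}

theorem Hom.ext_gen {f g : Hom A B} (h : ∀ x, f.toAlgHom (gen x) = g.toAlgHom (gen x)) : f = g :=
  Hom.ext (algHom_ext_gen h)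

@[simp] theorem Hom.comp_toAlgHom_apply (g : Hom B C) (f : Hom A B) (p : Free A.G) :
    (g.comp f).toAlgHom p = g.toAlgHom (f.toAlgHom p) := rfl

/-- A tame isomorphism of the underlying algebras that commutes with the differentials, as a
DGA morphism. -/
def Hom.ofTame (e : Free A.G ≃ₐ[ZMod 2] Free B.G) (he : IsTame A.deg B.deg e)
    (hd : ∀ x, e (A.d (gen x)) = B.d (e (gen x))) : Hom A B :=
  Hom.ofGen e.toAlgHom (fun x => he.mem_homog (gen_mem_homog _ x)) hd

theorem Hom.ofTame_isTameIso (e : Free A.G ≃ₐ[ZMod 2] Free B.G) (he : IsTame A.deg B.deg e)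
    (hd : ∀ x, e (A.d (gen x)) = B.d (e (gen x))) : (Hom.ofTame e he hd).IsTameIso :=
  ⟨e, he, rfl⟩

theorem Hom.IsTameIso.comp {g : Hom B C} {f : Hom A B} (hg : g.IsTameIso) (hf : f.IsTameIso) :
    (g.comp f).IsTameIso := by
  obtain ⟨e, he, h⟩ := hg
  obtain ⟨e', he', h'⟩ := hf
  exact ⟨e'.trans e, he'.trans he, by simp only [Hom.comp, h, h']; rfl⟩

/-- The inverse of a tame DGA isomorphism. -/
theorem Hom.IsTameIso.exists_inv {φ : Hom A B} (hφ : φ.IsTameIso) :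
    ∃ ψ : Hom B A, ψ.comp φ = Hom.id A ∧ φ.comp ψ = Hom.id B := by
  obtain ⟨e, he, h⟩ := hφ
  have hφe : ∀ p, φ.toAlgHom p = e p := fun p => DFunLike.congr_fun h p
  have hd : ∀ p, e (A.d p) = B.d (e p) := fun p => by rw [← hφe, ← hφe, φ.map_d]
  refine ⟨Hom.ofTame e.symm he.symm (fun x => ?_), Hom.ext_gen (fun x => ?_),
    Hom.ext_gen (fun x => ?_)⟩
  · rw [AlgEquiv.symm_apply_eq, hd, AlgEquiv.apply_symm_apply]
  · change e.symm (φ.toAlgHom (gen x)) = gen x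
    rw [hφe, AlgEquiv.symm_apply_apply]
  · change φ.toAlgHom (e.symm (gen x)) = gen x
    rw [hφe, AlgEquiv.apply_symm_apply]

theorem Homotopic.refl (f : Hom A B) : Homotopic f f :=
  ⟨0, by simp, by simp, by simp⟩

theorem Homotopic.comp_left {f g : Hom A B} (h : Hom B C) (H : Homotopic f g) :
    Homotopic (h.comp f) (h.comp g) := by
  obtain ⟨K, h1, h2, h3⟩ := H
  refine ⟨h.toAlgHom.toLinearMap ∘ₗ K, fun k p hp => h.map_homog _ _ (h1 k p hp), ?_, ?_⟩
  · intro p q; simp [h2]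
  · intro p
    have := congrArg h.toAlgHom (h3 p)
    simpa [h.map_d] using this

theorem Homotopic.comp_right {f g : Hom B C} (H : Homotopic f g) (h : Hom A B) :
    Homotopic (f.comp h) (g.comp h) := by
  obtain ⟨K, h1, h2, h3⟩ := H
  refine ⟨K ∘ₗ h.toAlgHom.toLinearMap, fun k p hp => h1 _ _ (h.map_homog k p hp), ?_, ?_⟩
  · intro p q; simp [h2]
  · intro p; simp [h3, h.map_d]

end Hom

section Stab

variable {ρ : ℕ} (A : TriDGA.{u} ρ) (J : Type u) (hJ : Finite J) (c : J → ZMod ρ)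

theorem TriDGA.stab_d_inl (p : Free A.G) :
    (A.stab J hJ c).d (rename (Sum.inl : A.G → StabGen A.G J) p) = rename Sum.inl (A.d p) :=
  ((A.toStab J hJ c).map_d p).symm

theorem TriDGA.stab_d_fst (j : J) :
    (A.stab J hJ c).d (gen (Sum.inr (Sum.inl j) : StabGen A.G J)) =
      gen (Sum.inr (Sum.inr j) : StabGen A.G J) :=
  der_gen _ _

theorem TriDGA.stab_d_snd (j : J) :
    (A.stab J hJ c).d (gen (Sum.inr (Sum.inr j) : StabGen A.G J)) = 0 :=
  der_gen _ _

section Desc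

variable {A} {C : TriDGA.{u} ρ} (φ : Hom A C) (z : J → Free C.G)

/-- The algebra map out of a stabilization given by a DGA map `φ` on `A` and the images `z` of the
generators `a_j`. -/
def TriDGA.stabAlg : Free (StabGen A.G J) →ₐ[ZMod 2] Free C.G :=
  FreeAlgebra.lift (ZMod 2)
    (Sum.elim (fun x => φ.toAlgHom (gen x)) (Sum.elim z (fun j => C.d (z j))))

theorem TriDGA.stabAlg_inl (x : A.G) :
    stabAlg J φ z (gen (Sum.inl x)) = φ.toAlgHom (gen x) := lift_gen _ _

theorem TriDGA.stabAlg_fst (j : J) : stabAlg J φ z (gen (Sum.inr (Sum.inl j))) = z j := lift_gen _ _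

theorem TriDGA.stabAlg_snd (j : J) :
    stabAlg J φ z (gen (Sum.inr (Sum.inr j))) = C.d (z j) := lift_gen _ _

theorem TriDGA.stabAlg_rename (p : Free A.G) :
    stabAlg J φ z (rename Sum.inl p) = φ.toAlgHom p := by
  have : (stabAlg J φ z).comp (rename Sum.inl) = φ.toAlgHom :=
    algHom_ext_gen (fun x => by rw [AlgHom.comp_apply, rename_gen, stabAlg_inl])
  exact DFunLike.congr_fun this p

/-- The DGA map out of a stabilization given by a DGA map `φ` on `A` and the images `z` of the
generators `a_j`. -/
def TriDGA.stabDesc (hz : ∀ j, z j ∈ homog C.deg (c j)) : Hom (A.stab J hJ c) C :=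
  Hom.ofGen (stabAlg J φ z)
    (by
      rintro (x | j | j)
      · exact (stabAlg_inl J φ z x).symm ▸ φ.map_homog _ _ (gen_mem_homog A.deg x)
      · exact (stabAlg_fst J φ z j).symm ▸ hz j
      · exact (stabAlg_snd J φ z j).symm ▸ C.d_homog _ _ (hz j))
    (by
      rintro (x | j | j)
      · have h := A.stab_d_inl J hJ c (gen x)
        rw [rename_gen] at h
        exact (congrArg (stabAlg J φ z) h).trans ((stabAlg_rename J φ z _).trans
          ((φ.map_d _).trans (congrArg C.d (stabAlg_inl J φ z x)).symm))
      · exact (congrArg (stabAlg J φ z) (A.stab_d_fst J hJ c j)).trans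
          ((stabAlg_snd J φ z j).trans (congrArg C.d (stabAlg_fst J φ z j)).symm)
      · refine (congrArg (stabAlg J φ z) (A.stab_d_snd J hJ c j)).trans
          ((map_zero _).trans (Eq.symm ?_))
        exact (congrArg C.d (stabAlg_snd J φ z j)).trans (C.d_d _))

theorem TriDGA.stabDesc_comp_toStab (hz : ∀ j, z j ∈ homog C.deg (c j)) :
    (stabDesc J hJ c φ z hz).comp (A.toStab J hJ c) = φ :=
  Hom.ext_gen (fun x => stabAlg_rename J φ z (gen x))

end Desc

/-- The retraction of a stabilization, which sends the new generators to zero. -/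
def TriDGA.retract : Hom (A.stab J hJ c) A :=
  stabDesc J hJ c (Hom.id A) (fun _ => 0) (fun _ => zero_mem _)

theorem TriDGA.retract_comp_toStab : (A.retract J hJ c).comp (A.toStab J hJ c) = Hom.id A :=
  stabDesc_comp_toStab _ _ _ _ _ _

variable [IsEmpty J]

/-- Immersed homotopy always compares stabilizations; the empty one is a relabelling, which lets
either side be left unstabilized. -/
theorem TriDGA.toStab_isTameIso : (A.toStab J hJ c).IsTameIso :=
  ⟨relabelEquiv (Equiv.sumEmpty A.G (J ⊕ J)).symm, .relabelEquiv _ (fun _ => rfl), rfl⟩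

theorem TriDGA.retract_isTameIso : (A.retract J hJ c).IsTameIso := by
  refine ⟨relabelEquiv (Equiv.sumEmpty A.G (J ⊕ J)), .relabelEquiv _ ?_, algHom_ext_gen ?_⟩
  · rintro (x | j | j)
    · rfl
    · exact isEmptyElim j
    · exact isEmptyElim j
  · rintro (x | j | j)
    · exact (TriDGA.stabAlg_inl J (Hom.id A) (fun _ => 0) x).trans
        (rename_gen (Equiv.sumEmpty A.G (J ⊕ J)) (Sum.inl x)).symm
    · exact isEmptyElim j
    · exact isEmptyElim j

end Stab

/-! ### Immersed homotopy classes -/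

namespace ImmersedMap

variable {ρ : ℕ} {A₁ A₂ : TriDGA.{u} ρ}

theorem i_gen (M : ImmersedMap A₁ A₂) (x : A₂.G) : M.i.toAlgHom (gen x) = gen (M.incl x) :=
  rename_gen _ _

/-- Both sides are stabilized by the empty family, and `φ` is conjugated by the resulting
relabellings. -/
theorem cls_eq_of_isTameIso {M M' : ImmersedMap A₁ A₂} (φ : Hom M.B M'.B) (hφ : φ.IsTameIso)
    (hi : φ.comp M.i = M'.i) (hf : Homotopic (φ.comp M.f) M'.f) : M.cls = M'.cls := by
  have hJ : Finite PEmpty.{u + 1} := inferInstance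
  set s := M.B.toStab PEmpty.{u + 1} hJ PEmpty.elim
  set s' := M'.B.toStab PEmpty.{u + 1} hJ PEmpty.elim
  set r := M.B.retract PEmpty.{u + 1} hJ PEmpty.elim
  have key : ∀ {A : TriDGA.{u} ρ} (g : Hom A M.B),
      (s'.comp (φ.comp r)).comp (s.comp g) = s'.comp (φ.comp g) := fun g =>
    congrArg (fun ψ => s'.comp (φ.comp (Hom.comp ψ g))) (M.B.retract_comp_toStab _ hJ PEmpty.elim)
  refine Quot.sound ⟨PEmpty, PEmpty, hJ, hJ, PEmpty.elim, PEmpty.elim, s'.comp (φ.comp r),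
    (M'.B.toStab_isTameIso _ _ _).comp (hφ.comp (M.B.retract_isTameIso _ _ _)), ?_, ?_⟩
  · rw [key, hi]
  · rw [key]
    exact hf.comp_left s'

/-- The immersed map `A₁ → B * S ↩ A₂` obtained by stabilizing `B`. -/
def stab (M : ImmersedMap A₁ A₂) (J : Type u) (hJ : Finite J) (c : J → ZMod ρ) :
    ImmersedMap A₁ A₂ where
  B := M.B.stab J hJ c
  f := (M.B.toStab J hJ c).comp M.f
  incl := M.incl.trans ⟨Sum.inl, Sum.inl_injective⟩
  deg_incl x := M.deg_incl x
  d_incl x := by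
    have h := M.B.stab_d_inl J hJ c (gen (M.incl x))
    rw [rename_gen, M.d_incl, rename_rename] at h
    exact h

theorem stab_i (M : ImmersedMap A₁ A₂) (J : Type u) (hJ : Finite J) (c : J → ZMod ρ) :
    (M.stab J hJ c).i = (M.B.toStab J hJ c).comp M.i :=
  Hom.ext_gen (fun x => by
    refine ((M.stab J hJ c).i_gen x).trans (Eq.symm ?_)
    exact (congrArg (M.B.toStab J hJ c).toAlgHom (M.i_gen x)).trans (rename_gen _ _))

/-- The immersed map with `f` replaced by another map. -/
def withMap (M : ImmersedMap A₁ A₂) (g : Hom A₁ M.B) : ImmersedMap A₁ A₂ := { M with f := g }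

/-- A function of immersed maps is invariant under immersed homotopy if it is invariant under
stabilizations, tame isomorphisms and homotopies of `f`. -/
theorem eq_of_immersedHomotopic {X : Type w} (F : ImmersedMap A₁ A₂ → X)
    (hstab : ∀ M J hJ c, F (M.stab J hJ c) = F M)
    (htame : ∀ (M M' : ImmersedMap A₁ A₂) (φ : Hom M.B M'.B), φ.IsTameIso →
      φ.comp M.i = M'.i → φ.comp M.f = M'.f → F M = F M')
    (hmap : ∀ (M : ImmersedMap A₁ A₂) (g : Hom A₁ M.B), Homotopic M.f g → F M = F (M.withMap g))
    {M M' : ImmersedMap A₁ A₂} (h : ImmersedHomotopic M M') : F M = F M' := by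
  obtain ⟨J, J', hJ, hJ', c, c', φ, hφ, hi, hf⟩ := h
  rw [← hstab M J hJ c, ← hstab M' J' hJ' c']
  -- The intermediate immersed map carries the transported map `φ ∘ f` on the stabilization of
  -- `M'.B`: the tame isomorphism reaches it strictly, and only the homotopy to `f'` remains.
  refine (htame (M.stab J hJ c) ((M'.stab J' hJ' c').withMap
    (φ.comp ((M.B.toStab J hJ c).comp M.f))) φ hφ ?_ rfl).trans ?_
  · exact (congrArg φ.comp (M.stab_i J hJ c)).trans (hi.trans (M'.stab_i J' hJ' c').symm)
  · exact hmap ((M'.stab J' hJ' c').withMap (φ.comp ((M.B.toStab J hJ c).comp M.f))) _ hf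

theorem cls_stab (M : ImmersedMap A₁ A₂) (J : Type u) (hJ : Finite J) (c : J → ZMod ρ) :
    (M.stab J hJ c).cls = M.cls := by
  refine (Quot.sound ⟨J, PEmpty, hJ, inferInstance, c, PEmpty.elim,
    (M.stab J hJ c).B.toStab _ _ _, TriDGA.toStab_isTameIso _ _ _ _, ?_, Homotopic.refl _⟩).symm
  rw [stab_i]
  rfl

end ImmersedMap

/-! ### Derivations over a pair of algebra maps -/

section TwistedDerivation

variable {G : Type u} {C : Type v} [Ring C] [Algebra (ZMod 2) C]

/-- The algebra map to upper triangular matrices with diagonal entries `f` and `g` and with the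
upper right entry prescribed on the generators. -/
def triangularHom (f g : Free G →ₐ[ZMod 2] C) (k : G → C) :
    Free G →ₐ[ZMod 2] Matrix (Fin 2) (Fin 2) C :=
  FreeAlgebra.lift (ZMod 2) (fun x => !![f (gen x), k x; 0, g (gen x)])

/-- Upper triangular matrices are closed under products, and their diagonal entries multiply
separately. The remaining entry is then an `(f, g)`-derivation, by the formula for the corner of a
product. -/
theorem triangularHom_apply (f g : Free G →ₐ[ZMod 2] C) (k : G → C) (p : Free G) :
    triangularHom f g k p = !![f p, triangularHom f g k p 0 1; 0, g p] := by
  induction p using FreeAlgebra.induction with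
  | grade0 c =>
    rw [AlgHom.commutes, AlgHom.commutes, AlgHom.commutes]
    ext i j
    fin_cases i <;> fin_cases j <;> simp [Matrix.algebraMap_matrix_apply]
  | grade1 x => simp [triangularHom, gen]
  | mul p q hp hq =>
    rw [map_mul, hp, hq]
    ext i j
    fin_cases i <;> fin_cases j <;> simp [Matrix.mul_apply, Fin.sum_univ_two]
  | add p q hp hq =>
    rw [map_add, hp, hq]
    ext i j
    fin_cases i <;> fin_cases j <;> simp

/-- The `(f, g)`-derivation with prescribed values on the generators. -/
def tder (f g : Free G →ₐ[ZMod 2] C) (k : G → C) : Free G →ₗ[ZMod 2] C where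
  toFun p := triangularHom f g k p 0 1
  map_add' p q := by simp
  map_smul' c p := by simp

variable (f g : Free G →ₐ[ZMod 2] C) (k : G → C)

@[simp] theorem tder_gen (x : G) : tder f g k (gen x) = k x := by
  change triangularHom f g k (gen x) 0 1 = k x
  simp [triangularHom]

theorem tder_mul (p q : Free G) : tder f g k (p * q) = tder f g k p * g q + f p * tder f g k q := by
  change triangularHom f g k (p * q) 0 1 = triangularHom f g k p 0 1 * g q +
    f p * triangularHom f g k q 0 1
  rw [map_mul, triangularHom_apply f g k p, triangularHom_apply f g k q]
  simp [Matrix.mul_apply, Fin.sum_univ_two, add_comm]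

end TwistedDerivation

/-! ### Twisted derivations on subalgebras spanned by sets of generators. -/

section DerivationProperties

variable {G : Type u} {C : Type v} [Ring C] [Algebra (ZMod 2) C]
  {f g : Free G →ₐ[ZMod 2] C} {K : Free G →ₗ[ZMod 2] C}

theorem derivation_one (hK : ∀ p q, K (p * q) = K p * g q + f p * K q) : K 1 = 0 := by
  simpa using hK 1 1

theorem derivation_algebraMap (hK : ∀ p q, K (p * q) = K p * g q + f p * K q) (c : ZMod 2) :
    K (algebraMap (ZMod 2) (Free G) c) = 0 := by
  rw [Algebra.algebraMap_eq_smul_one, map_smul, derivation_one hK, smul_zero]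

theorem derivation_mem_subalgebra (hK : ∀ p q, K (p * q) = K p * g q + f p * K q) {Y : Set G}
    {S : Subalgebra (ZMod 2) C} (h : ∀ y ∈ Y, f (gen y) ∈ S ∧ g (gen y) ∈ S ∧ K (gen y) ∈ S)
    {p : Free G} (hp : p ∈ subalg Y) : K p ∈ S := by
  have hf : ∀ q ∈ subalg Y, f q ∈ S := fun q => map_mem_of_mem_subalg (fun y hy => (h y hy).1)
  have hg : ∀ q ∈ subalg Y, g q ∈ S := fun q => map_mem_of_mem_subalg (fun y hy => (h y hy).2.1)
  unfold subalg at hp hf hg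
  induction hp using Algebra.adjoin_induction with
  | mem q hq =>
    obtain ⟨y, hy, rfl⟩ := hq
    exact (h y hy).2.2
  | algebraMap c => rw [derivation_algebraMap hK]; exact zero_mem S
  | add p q _ _ hp hq => rw [map_add]; exact add_mem hp hq
  | mul p q hp hq hp' hq' =>
    rw [hK]
    exact add_mem (mul_mem hp' (hg q hq)) (mul_mem (hf p hp) hq')

/-- This locality makes the later recursions well founded: with `p = ∂x`, the value of `K` at `p`
depends on `f`, `g` and `K` only at generators preceding `x`, even when the pair of algebra maps
varies. -/
theorem derivation_eq_of_mem_subalg {f' g' : Free G →ₐ[ZMod 2] C} {K' : Free G →ₗ[ZMod 2] C}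
    (hK : ∀ p q, K (p * q) = K p * g q + f p * K q)
    (hK' : ∀ p q, K' (p * q) = K' p * g' q + f' p * K' q) {Y : Set G}
    (h : ∀ y ∈ Y, f (gen y) = f' (gen y) ∧ g (gen y) = g' (gen y) ∧ K (gen y) = K' (gen y))
    {p : Free G} (hp : p ∈ subalg Y) : K p = K' p := by
  have hf : ∀ q ∈ subalg Y, f q = f' q := fun q => eq_of_mem_subalg (fun y hy => (h y hy).1)
  have hg : ∀ q ∈ subalg Y, g q = g' q := fun q => eq_of_mem_subalg (fun y hy => (h y hy).2.1)
  unfold subalg at hp hf hg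
  induction hp using Algebra.adjoin_induction with
  | mem q hq =>
    obtain ⟨y, hy, rfl⟩ := hq
    exact (h y hy).2.2
  | algebraMap c => rw [derivation_algebraMap hK, derivation_algebraMap hK']
  | add p q _ _ hp hq => rw [map_add, map_add, hp, hq]
  | mul p q hp hq hp' hq' => rw [hK, hK', hp', hq', hf p hp, hg q hq]

/-! ### Algebra maps and twisted derivations into an arbitrary graded target. -/

section Graded

variable {ρ : ℕ} {deg : G → ZMod ρ} (gr : ZMod ρ → Submodule (ZMod 2) C) [SetLike.GradedMonoid gr]

theorem map_mem_graded (hf : ∀ x, f (gen x) ∈ gr (deg x)) {n : ZMod ρ} {p : Free G}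
    (hp : p ∈ homog deg n) : f p ∈ gr n := by
  refine (?_ : homog deg n ≤ (gr n).comap f.toLinearMap) hp
  refine Submodule.span_le.2 ?_
  rintro _ ⟨l, rfl, rfl⟩
  change f (word l) ∈ gr _
  clear hp
  induction l with
  | nil => simpa [word] using SetLike.GradedOne.one_mem (A := gr)
  | cons a l ih =>
    have : f (word (a :: l)) = f (gen a) * f (word l) := by simp [word]
    rw [this]
    simpa using SetLike.GradedMul.mul_mem (hf a) ih

theorem derivation_mem_graded (hK : ∀ p q, K (p * q) = K p * g q + f p * K q)
    (hf : ∀ x, f (gen x) ∈ gr (deg x)) (hg : ∀ x, g (gen x) ∈ gr (deg x))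
    (hk : ∀ x, K (gen x) ∈ gr (deg x + 1)) {n : ZMod ρ} {p : Free G}
    (hp : p ∈ homog deg n) : K p ∈ gr (n + 1) := by
  refine (?_ : homog deg n ≤ (gr (n + 1)).comap K) hp
  refine Submodule.span_le.2 ?_
  rintro _ ⟨l, rfl, rfl⟩
  change K (word l) ∈ gr _
  clear hp
  induction l with
  | nil =>
    have : K (word ([] : List G)) = 0 := derivation_one hK
    rw [this]; exact zero_mem _
  | cons a l ih =>
    have hw : word (a :: l) = gen a * word l := by simp [word]
    have hl : g (word l) ∈ gr (l.map deg).sum :=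
      map_mem_graded gr hg (Submodule.subset_span ⟨l, rfl, rfl⟩)
    rw [hw, hK]
    refine add_mem ?_ ?_
    · have := SetLike.GradedMul.mul_mem (hk a) hl
      convert this using 2
      simp only [List.map_cons, List.sum_cons]; ring
    · have := SetLike.GradedMul.mul_mem (hf a) ih
      convert this using 2
      simp only [List.map_cons, List.sum_cons]; ring

instance homog_gradedMonoid (deg : G → ZMod ρ) : SetLike.GradedMonoid (homog deg) where
  one_mem := one_mem_homog deg
  mul_mem _ _ _ _ := mul_mem_homog deg

end Graded

end DerivationProperties

/-! ### Constructing homotopies out of triangular DGAs -/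

/-- A recursion over a rank function has a solution, which inherits every property that the
recursion step preserves. -/
theorem exists_fixedPoint {G : Type u} {X : Type v} [Finite G] (r : G → ℕ) (T : (G → X) → G → X)
    (hT : ∀ F F' x, (∀ y, r y < r x → F y = F' y) → T F x = T F' x) (P : (G → X) → Prop)
    (F₀ : G → X) (h₀ : P F₀) (hP : ∀ F, P F → P (T F)) : ∃ F, P F ∧ ∀ x, F x = T F x := by
  -- After `n` iterations the values at rank below `n` no longer change; ranks are bounded by some
  -- `N`, so the iterate `N + 1` is a fixed point.
  have key : ∀ n x, r x < n → T^[n] F₀ x = T^[n + 1] F₀ x := by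
    intro n
    induction n with
    | zero => intro x hx; omega
    | succ n ih =>
      intro x hx
      rw [Function.iterate_succ_apply', Function.iterate_succ_apply' T (n + 1)]
      exact hT _ _ _ (fun y hy => ih y (by omega))
  have hP' : ∀ n, P (T^[n] F₀) := by
    intro n
    induction n with
    | zero => exact h₀
    | succ n ih => rw [Function.iterate_succ_apply']; exact hP _ ih
  obtain ⟨N, hN⟩ := (Set.finite_range r).bddAbove
  refine ⟨T^[N + 1] F₀, hP' _, fun x => ?_⟩
  rw [key (N + 1) x (Nat.lt_succ_of_le (hN ⟨x, rfl⟩)), Function.iterate_succ_apply']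

section HomotopyConstruction

variable {ρ : ℕ} {C : Type v} [Ring C] [Algebra (ZMod 2) C]

/-- A graded algebra map out of a triangular DGA may be defined by recursion, where the value at a
generator depends only on the values at the generators in the differential. -/
theorem TriDGA.exists_algHom_rec (B : TriDGA.{u} ρ) (gr : ZMod ρ → Submodule (ZMod 2) C)
    (T : (Free B.G →ₐ[ZMod 2] C) → B.G → C)
    (hT : ∀ f f' x Y, B.d (gen x) ∈ subalg Y → (∀ y ∈ Y, f (gen y) = f' (gen y)) → T f x = T f' x)
    (hgr : ∀ f, (∀ x, f (gen x) ∈ gr (B.deg x)) → ∀ x, T f x ∈ gr (B.deg x)) :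
    ∃ f : Free B.G →ₐ[ZMod 2] C, (∀ x, f (gen x) ∈ gr (B.deg x)) ∧ ∀ x, f (gen x) = T f x := by
  obtain ⟨r, -, ht⟩ := B.triangular
  have := B.finite
  obtain ⟨F, hF, h⟩ := exists_fixedPoint r (fun F x => T (FreeAlgebra.lift (ZMod 2) F) x)
    (fun F F' x h => hT _ _ x _ (ht x) (fun y hy => by rw [lift_gen, lift_gen]; exact h y hy))
    (fun F => ∀ x, F x ∈ gr (B.deg x)) (fun _ => 0) (fun x => zero_mem _)
    (fun F hF => hgr _ (fun x => by rw [lift_gen]; exact hF x))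
  exact ⟨FreeAlgebra.lift (ZMod 2) F, fun x => by rw [lift_gen]; exact hF x,
    fun x => by rw [lift_gen]; exact h x⟩

/-- If the homotopy identity holds on the generators and one of the two maps is a chain map, then
the homotopy identity holds everywhere and both maps are chain maps. -/
theorem TriDGA.homotopy_of_gen (B : TriDGA.{u} ρ) (D : C →ₗ[ZMod 2] C)
    (hD : ∀ a b, D (a * b) = D a * b + a * D b) (hDD : ∀ a, D (D a) = 0)
    {f g : Free B.G →ₐ[ZMod 2] C} {K : Free B.G →ₗ[ZMod 2] C}
    (hK : ∀ p q, K (p * q) = K p * g q + f p * K q)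
    (h : ∀ x, f (gen x) - g (gen x) = D (K (gen x)) + K (B.d (gen x)))
    (hfg : (∀ x, f (B.d (gen x)) = D (f (gen x))) ∨ ∀ x, g (B.d (gen x)) = D (g (gen x)))
    (p : Free B.G) :
    f (B.d p) = D (f p) ∧ g (B.d p) = D (g p) ∧ f p - g p = D (K p) + K (B.d p) := by
  obtain ⟨r, -, ht⟩ := B.triangular
  have hD1 : D 1 = 0 := by simpa using hD 1 1
  have hB1 : B.d 1 = 0 := by simpa using B.d_mul 1 1
  -- The three identities must be carried together: the homotopy identity for a product uses that
  -- `f` and `g` commute with the differentials on the factors.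
  set P : Free B.G → Prop := fun p =>
    f (B.d p) = D (f p) ∧ g (B.d p) = D (g p) ∧ f p - g p = D (K p) + K (B.d p) with hP
  have hsub : ∀ Y : Set B.G, (∀ y ∈ Y, P (gen y)) → ∀ p ∈ subalg Y, P p := by
    intro Y hY p hp
    unfold subalg at hp
    induction hp using Algebra.adjoin_induction with
    | mem q hq => obtain ⟨y, hy, rfl⟩ := hq; exact hY y hy
    | algebraMap c =>
      refine ⟨?_, ?_, ?_⟩ <;>
        simp [Algebra.algebraMap_eq_smul_one, hB1, hD1, derivation_one hK]
    | add p q _ _ hp hq =>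
      obtain ⟨h1, h2, h3⟩ := hp
      obtain ⟨h4, h5, h6⟩ := hq
      refine ⟨by simp [h1, h4], by simp [h2, h5], ?_⟩
      simp only [map_add]
      rw [add_sub_add_comm, h3, h6]; abel
    | mul p q _ _ hp hq =>
      obtain ⟨h1, h2, h3⟩ := hp
      obtain ⟨h4, h5, h6⟩ := hq
      refine ⟨by simp [B.d_mul, hD, h1, h4], by simp [B.d_mul, hD, h2, h5], ?_⟩
      -- These cross terms occur once in `D (K (p * q))` and once in `K (∂(p * q))`, so they cancel
      -- modulo 2.
      have e1 := add_self_eq_zero_of_algebra (K p * D (g q))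
      have e2 := add_self_eq_zero_of_algebra (D (f p) * K q)
      rw [B.d_mul, map_add, hK, hK, hK, map_add, hD, hD, map_mul, map_mul, h1, h5]
      calc f p * f q - g p * g q = (f p - g p) * g q + f p * (f q - g q) := by noncomm_ring
        _ = (D (K p) + K (B.d p)) * g q + f p * (D (K q) + K (B.d q)) +
          (K p * D (g q) + K p * D (g q)) + (D (f p) * K q + D (f p) * K q) := by
            rw [h3, h6, e1, e2, add_zero, add_zero]
        _ = _ := by noncomm_ring
  have hgen : ∀ n x, r x = n → P (gen x) := by
    intro n
    induction n using Nat.strong_induction_on with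
    | _ n ih =>
      intro x hx
      have hd : P (B.d (gen x)) := hsub _ (fun y hy => ih (r y) (hx ▸ hy) y rfl) _ (ht x)
      -- Applying `D` to the identity at `x` gives `D f x - D g x = D K ∂x`; the identity at `∂x`,
      -- known by induction, gives `f ∂x - g ∂x = D K ∂x`. Hence `f` commutes with the differentials
      -- at `x` exactly when `g` does.
      have e1 := congrArg D (h x)
      rw [map_add, map_sub, hDD, zero_add] at e1
      have e2 := hd.2.2
      rw [B.d_d, map_zero, add_zero, ← e1] at e2
      rcases hfg with hf | hg
      · refine ⟨hf x, ?_, h x⟩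
        rw [hf x] at e2
        exact sub_right_injective e2
      · refine ⟨?_, hg x, h x⟩
        rw [hg x] at e2
        exact sub_left_injective e2
  exact hsub Set.univ (fun y _ => hgen _ y rfl) p (mem_subalg_univ p)

variable {A₁ A₂ : TriDGA.{u} ρ} (M : ImmersedMap A₁ A₂) (D : C →ₗ[ZMod 2] C)
  (gr : ZMod ρ → Submodule (ZMod 2) C)

/-- The values of `H` on the generators coming from `A₂`, and zero on the others. -/
noncomputable def ImmersedMap.extendGen {X : Type v} [Zero X] (H : A₂.G → X) : M.B.G → X :=
  Function.extend M.incl H 0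

theorem ImmersedMap.extendGen_incl {X : Type v} [Zero X] (H : A₂.G → X) (a : A₂.G) :
    M.extendGen H (M.incl a) = H a :=
  M.incl.injective.extend_apply H 0 a

theorem ImmersedMap.extendGen_new {X : Type v} [Zero X] (H : A₂.G → X) (b : M.B.G)
    (hb : b ∉ Set.range M.incl) : M.extendGen H b = 0 :=
  Function.extend_apply' _ _ _ (fun ⟨a, ha⟩ => hb ⟨a, ha⟩)

theorem ImmersedMap.extendGen_mem_graded (H : A₂.G → C) (n : ZMod ρ)
    (hH : ∀ a, H a ∈ gr (A₂.deg a + n)) (b : M.B.G) : M.extendGen H b ∈ gr (M.B.deg b + n) := by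
  by_cases hb : b ∈ Set.range M.incl
  · obtain ⟨a, rfl⟩ := hb
    rw [extendGen_incl, M.deg_incl]; exact hH a
  · rw [extendGen_new M H b hb]; exact zero_mem _

/-! ### Homotopy extension along an inclusion of generators. -/

section Extension

variable [SetLike.GradedMonoid gr]

/-- The homotopy extension property, with the second map given on the larger DGA. -/
theorem ImmersedMap.exists_extension_left (hD : ∀ a b, D (a * b) = D a * b + a * D b)
    (hDD : ∀ a, D (D a) = 0) {g : Free M.B.G →ₐ[ZMod 2] C}
    (hg : ∀ x, g (gen x) ∈ gr (M.B.deg x)) (hgd : ∀ p, g (M.B.d p) = D (g p))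
    {f₀ : Free A₂.G →ₐ[ZMod 2] C} (hf₀ : ∀ x, f₀ (gen x) ∈ gr (A₂.deg x))
    {H : Free A₂.G →ₗ[ZMod 2] C} (hH : ∀ x, H (gen x) ∈ gr (A₂.deg x + 1))
    (hHm : ∀ p q, H (p * q) = H p * g (M.i.toAlgHom q) + f₀ p * H q)
    (hHh : ∀ p, f₀ p - g (M.i.toAlgHom p) = D (H p) + H (A₂.d p)) :
    ∃ (f : Free M.B.G →ₐ[ZMod 2] C) (K : Free M.B.G →ₗ[ZMod 2] C),
      (∀ x, f (gen x) ∈ gr (M.B.deg x)) ∧ (∀ p, f (M.B.d p) = D (f p)) ∧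
      f.comp M.i.toAlgHom = f₀ ∧ (∀ x, K (gen x) ∈ gr (M.B.deg x + 1)) ∧
      (∀ p q, K (p * q) = K p * g q + f p * K q) ∧ (∀ p, f p - g p = D (K p) + K (M.B.d p)) ∧
      (∀ x, K (gen (M.incl x)) = H (gen x)) ∧ ∀ b ∉ Set.range M.incl, K (gen b) = 0 := by
  classical
  set k : M.B.G → C := M.extendGen (fun a => H (gen a)) with hk
  have hkgr : ∀ b, k b ∈ gr (M.B.deg b + 1) := M.extendGen_mem_graded gr _ 1 hH
  set F₀ : M.B.G → C := M.extendGen (fun a => f₀ (gen a)) with hF₀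
  have hF₀gr : ∀ b, F₀ b ∈ gr (M.B.deg b) := fun b => by
    simpa using M.extendGen_mem_graded gr (fun a => f₀ (gen a)) 0 (by simpa using hf₀) b
  -- As `K` is zero on a new generator `b`, the homotopy identity forces `f b = g b + K (∂b)`. Here
  -- `K` is itself twisted by the unknown `f`, but `K (∂b)` uses `f` only at the generators
  -- occurring in `∂b`.
  obtain ⟨f, hf, hrec⟩ := M.B.exists_algHom_rec gr
    (fun f b => if b ∈ Set.range M.incl then F₀ b else g (gen b) + tder f g k (M.B.d (gen b)))
    (fun f f' x Y hY h => by
      rw [derivation_eq_of_mem_subalg (tder_mul f g k) (tder_mul f' g k)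
        (fun y hy => ⟨h y hy, rfl, by simp⟩) hY])
    (fun f hf x => by
      split_ifs
      · exact hF₀gr x
      · refine add_mem (hg x) ?_
        have := derivation_mem_graded gr (tder_mul f g k) hf hg (by simpa using hkgr)
          (M.B.d_homog _ _ (gen_mem_homog _ x))
        rwa [sub_add_cancel] at this)
  have hfi : f.comp M.i.toAlgHom = f₀ := algHom_ext_gen (fun a => by
    rw [AlgHom.comp_apply, M.i_gen, hrec, if_pos ⟨a, rfl⟩, hF₀, M.extendGen_incl])
  have hKi : ∀ p, tder f g k (M.i.toAlgHom p) = H p := by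
    refine derivation_ext f₀ (g.comp M.i.toAlgHom) (tder f g k ∘ₗ M.i.toAlgHom.toLinearMap) H
      (fun p q => ?_) hHm (fun a => ?_)
    · simp [tder_mul, ← hfi]
    · simp [M.i_gen, hk, M.extendGen_incl]
  have hnew : ∀ b ∉ Set.range M.incl, k b = 0 := fun b hb => M.extendGen_new _ b hb
  have hgen : ∀ b, f (gen b) - g (gen b) =
      D (tder f g k (gen b)) + tder f g k (M.B.d (gen b)) := by
    intro b
    by_cases hb : b ∈ Set.range M.incl
    · obtain ⟨a, rfl⟩ := hb
      have := hHh (gen a)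
      rw [← hfi, AlgHom.comp_apply, ← hKi, ← hKi, M.i.map_d, M.i_gen] at this
      exact this
    · rw [hrec, if_neg hb, tder_gen, hnew b hb, map_zero, zero_add, add_sub_cancel_left]
  -- That `f` is a chain map is not built into the recursion; it follows from the homotopy identity
  -- because `g` is one.
  have key := M.B.homotopy_of_gen D hD hDD (tder_mul f g k) hgen (Or.inr fun x => hgd _)
  exact ⟨f, tder f g k, hf, fun p => (key p).1, hfi, by simpa using hkgr, tder_mul f g k,
    fun p => (key p).2.2, by simp [hk, M.extendGen_incl], fun b hb => by rw [tder_gen, hnew b hb]⟩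

/-- The homotopy extension property, with the first map given on the larger DGA. -/
theorem ImmersedMap.exists_extension_right (hD : ∀ a b, D (a * b) = D a * b + a * D b)
    (hDD : ∀ a, D (D a) = 0) {f : Free M.B.G →ₐ[ZMod 2] C}
    (hf : ∀ x, f (gen x) ∈ gr (M.B.deg x)) (hfd : ∀ p, f (M.B.d p) = D (f p))
    {g₀ : Free A₂.G →ₐ[ZMod 2] C} (hg₀ : ∀ x, g₀ (gen x) ∈ gr (A₂.deg x))
    {H : Free A₂.G →ₗ[ZMod 2] C} (hH : ∀ x, H (gen x) ∈ gr (A₂.deg x + 1))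
    (hHm : ∀ p q, H (p * q) = H p * g₀ q + f (M.i.toAlgHom p) * H q)
    (hHh : ∀ p, f (M.i.toAlgHom p) - g₀ p = D (H p) + H (A₂.d p)) :
    ∃ (g : Free M.B.G →ₐ[ZMod 2] C) (K : Free M.B.G →ₗ[ZMod 2] C),
      (∀ x, g (gen x) ∈ gr (M.B.deg x)) ∧ (∀ p, g (M.B.d p) = D (g p)) ∧
      g.comp M.i.toAlgHom = g₀ ∧ (∀ x, K (gen x) ∈ gr (M.B.deg x + 1)) ∧
      (∀ p q, K (p * q) = K p * g q + f p * K q) ∧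
      ∀ p, f p - g p = D (K p) + K (M.B.d p) := by
  classical
  set k : M.B.G → C := M.extendGen (fun a => H (gen a)) with hk
  have hkgr : ∀ b, k b ∈ gr (M.B.deg b + 1) := M.extendGen_mem_graded gr _ 1 hH
  set F₀ : M.B.G → C := M.extendGen (fun a => g₀ (gen a)) with hF₀
  have hF₀gr : ∀ b, F₀ b ∈ gr (M.B.deg b) := fun b => by
    simpa using M.extendGen_mem_graded gr (fun a => g₀ (gen a)) 0 (by simpa using hg₀) b
  -- The same identity is now solved for the second map, `g b = f b - K (∂b)`. Having both versions
  -- avoids any appeal to the symmetry of homotopy.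
  obtain ⟨g, hg, hrec⟩ := M.B.exists_algHom_rec gr
    (fun g b => if b ∈ Set.range M.incl then F₀ b else f (gen b) - tder f g k (M.B.d (gen b)))
    (fun g g' x Y hY h => by
      rw [derivation_eq_of_mem_subalg (tder_mul f g k) (tder_mul f g' k)
        (fun y hy => ⟨rfl, h y hy, by simp⟩) hY])
    (fun g hg x => by
      split_ifs
      · exact hF₀gr x
      · refine sub_mem (hf x) ?_
        have := derivation_mem_graded gr (tder_mul f g k) hf hg (by simpa using hkgr)
          (M.B.d_homog _ _ (gen_mem_homog _ x))
        rwa [sub_add_cancel] at this)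
  have hgi : g.comp M.i.toAlgHom = g₀ := algHom_ext_gen (fun a => by
    rw [AlgHom.comp_apply, M.i_gen, hrec, if_pos ⟨a, rfl⟩, hF₀, M.extendGen_incl])
  have hKi : ∀ p, tder f g k (M.i.toAlgHom p) = H p := by
    refine derivation_ext (f.comp M.i.toAlgHom) g₀ (tder f g k ∘ₗ M.i.toAlgHom.toLinearMap) H
      (fun p q => ?_) hHm (fun a => ?_)
    · simp [tder_mul, ← hgi]
    · simp [M.i_gen, hk, M.extendGen_incl]
  have hgen : ∀ b, f (gen b) - g (gen b) =
      D (tder f g k (gen b)) + tder f g k (M.B.d (gen b)) := by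
    intro b
    by_cases hb : b ∈ Set.range M.incl
    · obtain ⟨a, rfl⟩ := hb
      have := hHh (gen a)
      rw [← hgi, AlgHom.comp_apply, ← hKi, ← hKi, M.i.map_d, M.i_gen] at this
      exact this
    · rw [hrec, if_neg hb, tder_gen, hk, M.extendGen_new _ b hb, map_zero, zero_add,
        sub_sub_cancel]
  have key := M.B.homotopy_of_gen D hD hDD (tder_mul f g k) hgen (Or.inl fun x => hfd _)
  exact ⟨g, tder f g k, hg, fun p => (key p).2.1, hgi, by simpa using hkgr, tder_mul f g k,
    fun p => (key p).2.2⟩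

end Extension

/-- A DGA map may be deformed along arbitrary values of a homotopy on the generators. -/
theorem Hom.exists_homotopic {A B : TriDGA.{u} ρ} (g : Hom A B) (k : A.G → Free B.G)
    (hk : ∀ x, k x ∈ homog B.deg (A.deg x + 1)) :
    ∃ f : Hom A B, Homotopic f g ∧ ∀ x, f.toAlgHom (gen x) = g.toAlgHom (gen x) + B.d (k x) +
      tder f.toAlgHom g.toAlgHom k (A.d (gen x)) := by
  have hg : ∀ x, g.toAlgHom (gen x) ∈ homog B.deg (A.deg x) :=
    fun x => g.map_homog _ _ (gen_mem_homog _ x)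
  -- The recursion is `f - g = ∂K + K∂` solved for `f` at a generator, with `K x = k x` prescribed.
  obtain ⟨f, hf, hrec⟩ := A.exists_algHom_rec (homog B.deg)
    (fun f x => g.toAlgHom (gen x) + B.d (k x) + tder f g.toAlgHom k (A.d (gen x)))
    (fun f f' x Y hY h => by
      rw [derivation_eq_of_mem_subalg (tder_mul f _ k) (tder_mul f' _ k)
        (fun y hy => ⟨h y hy, rfl, by simp⟩) hY])
    (fun f hf x => by
      refine add_mem (add_mem (hg x) ?_) ?_
      · have := B.d_homog _ _ (hk x)
        rwa [add_sub_cancel_right] at this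
      · have := derivation_mem_graded (homog B.deg) (tder_mul f g.toAlgHom k) hf hg
          (by simpa using hk) (A.d_homog _ _ (gen_mem_homog _ x))
        rwa [sub_add_cancel] at this)
  have key := A.homotopy_of_gen B.d B.d_mul B.d_d (tder_mul f g.toAlgHom k)
    (fun x => by rw [hrec, tder_gen]; abel) (Or.inr fun x => g.map_d _)
  refine ⟨⟨f, fun n p hp => map_mem_homog f hf hp, fun p => (key p).1⟩,
    ⟨tder f g.toAlgHom k, fun n p hp => ?_, tder_mul f g.toAlgHom k, fun p => (key p).2.2⟩, hrec⟩
  exact derivation_mem_graded (homog B.deg) (tder_mul f g.toAlgHom k) hf hg (by simpa using hk) hp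

end HomotopyConstruction

/-! ### Amalgamated unions of generating sets -/

section SplitRange

/-- A set is the disjoint union of the image of an injection and its complement. -/
noncomputable def splitEquiv {A G : Type u} (i : A ↪ G) : {b : G // b ∉ Set.range i} ⊕ A ≃ G :=
  Equiv.ofBijective (Sum.elim Subtype.val i) (by
    constructor
    · rintro (b | c) (b' | c') h <;> simp only [Sum.elim_inl, Sum.elim_inr] at h
      · rw [Subtype.ext h]
      · exact absurd ⟨c', h.symm⟩ b.2
      · exact absurd ⟨c, h⟩ b'.2
      · rw [i.injective h]
    · intro b
      by_cases hb : b ∈ Set.range i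
      · obtain ⟨a, rfl⟩ := hb; exact ⟨Sum.inr a, rfl⟩
      · exact ⟨Sum.inl ⟨b, hb⟩, rfl⟩)

variable {A G G' : Type u} (i : A ↪ G) (j : A ↪ G')

theorem splitEquiv_symm_apply (a : A) : (splitEquiv i).symm (i a) = Sum.inr a :=
  (splitEquiv i).symm_apply_eq.2 rfl

theorem splitEquiv_symm_new (b : G) (hb : b ∉ Set.range i) :
    (splitEquiv i).symm b = Sum.inl ⟨b, hb⟩ :=
  (splitEquiv i).symm_apply_eq.2 rfl

/-- Two descriptions of the amalgamated union of `G` and `G'` along `A`. -/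
noncomputable def amalgamEquiv :
    {b : G // b ∉ Set.range i} ⊕ G' ≃ {c : G' // c ∉ Set.range j} ⊕ G :=
  (Equiv.sumCongr (Equiv.refl _) (splitEquiv j).symm).trans <|
    (Equiv.sumAssoc _ _ _).symm.trans <|
    (Equiv.sumCongr (Equiv.sumComm _ _) (Equiv.refl _)).trans <|
      (Equiv.sumAssoc _ _ _).trans <| Equiv.sumCongr (Equiv.refl _) (splitEquiv i)

theorem amalgamEquiv_inl (b : {b : G // b ∉ Set.range i}) :
    amalgamEquiv i j (Sum.inl b) = Sum.inr b.1 := rfl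

theorem amalgamEquiv_inr_apply (a : A) : amalgamEquiv i j (Sum.inr (j a)) = Sum.inr (i a) := by
  simp only [amalgamEquiv, Equiv.trans_apply, Equiv.sumCongr_apply, Sum.map_inr,
    splitEquiv_symm_apply]
  rfl

theorem amalgamEquiv_inr_new (c : G') (hc : c ∉ Set.range j) :
    amalgamEquiv i j (Sum.inr c) = Sum.inl ⟨c, hc⟩ := by
  simp [amalgamEquiv, splitEquiv_symm_new j c hc]

theorem amalgamEquiv_deg {ρ : ℕ} {deg : G → ZMod ρ} {deg' : G' → ZMod ρ}
    (h : ∀ a, deg (i a) = deg' (j a)) (x : {b : G // b ∉ Set.range i} ⊕ G') :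
    Sum.elim (fun c : {c : G' // c ∉ Set.range j} => deg' c.1) deg (amalgamEquiv i j x) =
      Sum.elim (fun b : {b : G // b ∉ Set.range i} => deg b.1) deg' x := by
  rcases x with b | c
  · rfl
  · by_cases hc : c ∈ Set.range j
    · obtain ⟨a, rfl⟩ := hc
      rw [amalgamEquiv_inr_apply]
      exact h a
    · rw [amalgamEquiv_inr_new i j c hc]; rfl

end SplitRange

/-! ### Maps out of push-outs -/

section Pushout

variable {ρ : ℕ} {A₁ A₂ A₃ A₄ : TriDGA.{u} ρ} (M₂ : ImmersedMap A₂ A₃) (M₁ : ImmersedMap A₁ A₂)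

/-- `p₂ : B₂ → B` as a DGA morphism. -/
noncomputable def pushHom₂ : Hom M₂.B (pushout M₂ M₁) where
  toAlgHom := pushInr M₂ M₁
  map_homog := pushInr_homog M₂ M₁
  map_d := pushInr_d M₂ M₁

theorem pushHom_square :
    (pushHom₁ M₂ M₁).comp M₁.i = (pushHom₂ M₂ M₁).comp M₂.f :=
  Hom.ext (AlgHom.ext (push_square M₂ M₁))

theorem comp_i : (M₂.comp M₁).i = (pushHom₂ M₂ M₁).comp M₂.i :=
  Hom.ext_gen (fun x => by
    refine ((M₂.comp M₁).i_gen x).trans (Eq.symm ?_)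
    exact (congrArg (pushInr M₂ M₁) (M₂.i_gen x)).trans (pushInr_gen _ _ _))

variable {M₂ M₁}

/-- An algebra map out of the push-out that is given by compatible maps out of `B₁` and `B₂` on the
generators is given by them everywhere. -/
theorem push_hom_apply {R : Type v} [Ring R] [Algebra (ZMod 2) R]
    (e : Free (PushGen M₂ M₁) →ₐ[ZMod 2] R) (u : Free M₁.B.G →ₐ[ZMod 2] R)
    (v : Free M₂.B.G →ₐ[ZMod 2] R)
    (huv : ∀ a, u (M₁.i.toAlgHom (gen a)) = v (M₂.f.toAlgHom (gen a)))
    (hu : ∀ b, e (gen (Sum.inl b)) = u (gen b.1)) (hv : ∀ c, e (gen (Sum.inr c)) = v (gen c)) :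
    (∀ p, e (pushInl M₂ M₁ p) = u p) ∧ ∀ p, e (pushInr M₂ M₁ p) = v p := by
  have hr : e.comp (pushInr M₂ M₁) = v :=
    algHom_ext_gen (fun c => by rw [AlgHom.comp_apply, pushInr_gen, hv])
  have hl : e.comp (pushInl M₂ M₁) = u := algHom_ext_gen (fun b => by
    by_cases hb : b ∈ Set.range M₁.incl
    · obtain ⟨a, rfl⟩ := hb
      rw [AlgHom.comp_apply, pushInl_incl, ← M₁.i_gen, huv]
      exact DFunLike.congr_fun hr _
    · rw [AlgHom.comp_apply, pushInl_new M₂ M₁ b hb, hu])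
  exact ⟨DFunLike.congr_fun hl, DFunLike.congr_fun hr⟩

/-- The differential of a generator of the push-out is the image under `p₁` or `p₂` of its
differential in `B₁` or `B₂`, and on those images `e` is the chain map `u` or `v`. -/
theorem push_map_d_gen {B : TriDGA.{u} ρ} (e : Free (PushGen M₂ M₁) →ₐ[ZMod 2] Free B.G)
    (u : Hom M₁.B B) (v : Hom M₂.B B) (huv : u.comp M₁.i = v.comp M₂.f)
    (hu : ∀ b, e (gen (Sum.inl b)) = u.toAlgHom (gen b.1))
    (hv : ∀ c, e (gen (Sum.inr c)) = v.toAlgHom (gen c)) (x : PushGen M₂ M₁) :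
    e (der (pushδ M₂ M₁) (gen x)) = B.d (e (gen x)) := by
  obtain ⟨h1, h2⟩ := push_hom_apply e u.toAlgHom v.toAlgHom
    (fun a => congrArg (fun φ : Hom A₂ B => φ.toAlgHom (gen a)) huv) hu hv
  rw [der_gen]
  rcases x with b | c
  · rw [hu, ← u.map_d]; exact h1 _
  · rw [hv, ← v.map_d]; exact h2 _

/-- The DGA map out of the push-out given by compatible maps out of `B₁` and `B₂`. -/
noncomputable def pushDesc {B : TriDGA.{u} ρ} (u : Hom M₁.B B) (v : Hom M₂.B B)
    (huv : u.comp M₁.i = v.comp M₂.f) : Hom (pushout M₂ M₁) B :=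
  Hom.ofGen (FreeAlgebra.lift (ZMod 2)
      (Sum.elim (fun b => u.toAlgHom (gen b.1)) (fun c => v.toAlgHom (gen c)) :
        PushGen M₂ M₁ → Free B.G))
    (by
      rintro (b | c)
      · exact (lift_gen (B := Free B.G) _ (Sum.inl b : PushGen M₂ M₁)).symm ▸
          u.map_homog _ _ (gen_mem_homog _ b.1)
      · exact (lift_gen (B := Free B.G) _ (Sum.inr c : PushGen M₂ M₁)).symm ▸
          v.map_homog _ _ (gen_mem_homog _ c))
    (push_map_d_gen _ u v huv (fun _ => lift_gen _ _) (fun _ => lift_gen _ _))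

theorem pushDesc_inl {B : TriDGA.{u} ρ} (u : Hom M₁.B B) (v : Hom M₂.B B)
    (huv : u.comp M₁.i = v.comp M₂.f) (b : {b : M₁.B.G // b ∉ Set.range M₁.incl}) :
    (pushDesc u v huv).toAlgHom (gen (Sum.inl b : PushGen M₂ M₁)) = u.toAlgHom (gen b.1) :=
  lift_gen _ _

theorem pushDesc_inr {B : TriDGA.{u} ρ} (u : Hom M₁.B B) (v : Hom M₂.B B)
    (huv : u.comp M₁.i = v.comp M₂.f) (c : M₂.B.G) :
    (pushDesc u v huv).toAlgHom (gen (Sum.inr c : PushGen M₂ M₁)) = v.toAlgHom (gen c) :=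
  lift_gen _ _

theorem pushDesc_comp_pushHom₂ {B : TriDGA.{u} ρ} (u : Hom M₁.B B) (v : Hom M₂.B B)
    (huv : u.comp M₁.i = v.comp M₂.f) : (pushDesc u v huv).comp (pushHom₂ M₂ M₁) = v :=
  Hom.ext (AlgHom.ext (push_hom_apply _ u.toAlgHom v.toAlgHom
    (fun a => congrArg (fun φ : Hom A₂ B => φ.toAlgHom (gen a)) huv)
    (pushDesc_inl u v huv) (pushDesc_inr u v huv)).2)

theorem pushDesc_comp_pushHom₁ {B : TriDGA.{u} ρ} (u : Hom M₁.B B) (v : Hom M₂.B B)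
    (huv : u.comp M₁.i = v.comp M₂.f) : (pushDesc u v huv).comp (pushHom₁ M₂ M₁) = u :=
  Hom.ext (AlgHom.ext (push_hom_apply _ u.toAlgHom v.toAlgHom
    (fun a => congrArg (fun φ : Hom A₂ B => φ.toAlgHom (gen a)) huv)
    (pushDesc_inl u v huv) (pushDesc_inr u v huv)).1)

/-- A tame isomorphism out of the push-out, given by compatible DGA maps out of `B₁` and `B₂`,
determines the immersed homotopy class of the composition. -/
theorem comp_cls_eq (M : ImmersedMap A₁ A₃) (e : Free (PushGen M₂ M₁) ≃ₐ[ZMod 2] Free M.B.G)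
    (he : IsTame (pushDeg M₂ M₁) M.B.deg e) (u : Hom M₁.B M.B) (v : Hom M₂.B M.B)
    (huv : u.comp M₁.i = v.comp M₂.f)
    (hu : ∀ b, e (gen (Sum.inl b)) = u.toAlgHom (gen b.1))
    (hv : ∀ c, e (gen (Sum.inr c)) = v.toAlgHom (gen c))
    (hi : v.comp M₂.i = M.i) (hf : Homotopic (u.comp M₁.f) M.f) :
    (M₂.comp M₁).cls = M.cls := by
  have hd := push_map_d_gen e.toAlgHom u v huv hu hv
  obtain ⟨h1, h2⟩ := push_hom_apply e.toAlgHom u.toAlgHom v.toAlgHom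
    (fun a => congrArg (fun φ : Hom A₂ M.B => φ.toAlgHom (gen a)) huv) hu hv
  set φ : Hom (pushout M₂ M₁) M.B := Hom.ofTame e he hd with hφ
  have e1 : φ.comp (pushHom₁ M₂ M₁) = u := Hom.ext (AlgHom.ext h1)
  have e2 : φ.comp (pushHom₂ M₂ M₁) = v := Hom.ext (AlgHom.ext h2)
  refine ImmersedMap.cls_eq_of_isTameIso φ (Hom.ofTame_isTameIso (A := pushout M₂ M₁) e he hd) ?_ ?_
  · rw [comp_i, ← hi, ← e2]; rfl
  · rw [← e1] at hf; exact hf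

theorem comp_cls_eq_of_relabel (M : ImmersedMap A₁ A₃) (σ : PushGen M₂ M₁ ≃ M.B.G)
    (hσ : ∀ x, M.B.deg (σ x) = pushDeg M₂ M₁ x) (u : Hom M₁.B M.B) (v : Hom M₂.B M.B)
    (huv : u.comp M₁.i = v.comp M₂.f)
    (hu : ∀ b, gen (σ (Sum.inl b)) = u.toAlgHom (gen b.1))
    (hv : ∀ c, gen (σ (Sum.inr c)) = v.toAlgHom (gen c))
    (hi : v.comp M₂.i = M.i) (hf : u.comp M₁.f = M.f) :
    (M₂.comp M₁).cls = M.cls :=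
  comp_cls_eq M (relabelEquiv σ) (.relabelEquiv σ hσ) u v huv
    (fun b => by rw [relabelEquiv_apply, rename_gen, hu])
    (fun c => by rw [relabelEquiv_apply, rename_gen, hv]) hi (hf ▸ Homotopic.refl _)

/-! ### Unit and associativity laws -/

theorem ImmersedMap.id_i (A : TriDGA.{u} ρ) : (ImmersedMap.id A).i = Hom.id A :=
  Hom.ext_gen (fun x => (ImmersedMap.id A).i_gen x)

/-- The identity map has no generators outside the image of its inclusion, so the push-out adds
nothing to `M.B`. -/
theorem cls_comp_id (M : ImmersedMap A₁ A₂) : (M.comp (ImmersedMap.id A₁)).cls = M.cls := by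
  have hE : IsEmpty {b : (ImmersedMap.id A₁).B.G // b ∉ Set.range (ImmersedMap.id A₁).incl} :=
    ⟨fun b => b.2 ⟨b.1, rfl⟩⟩
  refine comp_cls_eq_of_relabel M (Equiv.emptySum _ _) ?_ M.f (Hom.id _) ?_ (fun b => hE.elim b)
    (fun c => rfl) rfl rfl
  · rintro (b | c)
    · exact hE.elim b
    · rfl
  · exact congrArg M.f.comp (ImmersedMap.id_i A₁)

theorem cls_id_comp (M : ImmersedMap A₁ A₂) : ((ImmersedMap.id A₂).comp M).cls = M.cls := by
  refine comp_cls_eq_of_relabel M (splitEquiv M.incl) ?_ (Hom.id _) M.i rfl (fun b => rfl)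
    (fun c => (M.i_gen c).symm) ?_ rfl
  · rintro (b | c)
    · rfl
    · exact M.deg_incl c
  · exact congrArg M.i.comp (ImmersedMap.id_i A₂)

/-- The bijection between the generators of the two iterated push-outs. -/
def assocEquiv (M₃ : ImmersedMap A₃ A₄) (M₂ : ImmersedMap A₂ A₃) (M₁ : ImmersedMap A₁ A₂) :
    PushGen (M₃.comp M₂) M₁ ≃ PushGen M₃ (M₂.comp M₁) where
  toFun := Sum.elim
    (fun b => Sum.inl ⟨(Sum.inl b : PushGen M₂ M₁), fun ⟨_, h⟩ => Sum.inr_ne_inl h⟩)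
    (Sum.elim (fun b => Sum.inl ⟨(Sum.inr b.1 : PushGen M₂ M₁), fun ⟨a, h⟩ =>
      b.2 ⟨a, Sum.inr_injective h⟩⟩) (fun c => Sum.inr c) : PushGen M₃ M₂ → _)
  invFun := Sum.elim
    (fun x => match x with
      | ⟨Sum.inl b, _⟩ => Sum.inl b
      | ⟨Sum.inr b, h⟩ => Sum.inr (Sum.inl ⟨b, fun ⟨a, ha⟩ => h ⟨a, congrArg Sum.inr ha⟩⟩ :
          PushGen M₃ M₂))
    (fun c => Sum.inr (Sum.inr c : PushGen M₃ M₂))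
  left_inv := by rintro (b | b | c) <;> rfl
  right_inv := by rintro (⟨b | b, h⟩ | c) <;> rfl

/-- Both iterated push-outs are generated by the new generators of `B₁`, the new generators of `B₂`
and all generators of `B₃`; the universal property shows that the relabelling respects the structure
maps. -/
theorem cls_assoc (M₃ : ImmersedMap A₃ A₄) (M₂ : ImmersedMap A₂ A₃) (M₁ : ImmersedMap A₁ A₂) :
    ((M₃.comp M₂).comp M₁).cls = (M₃.comp (M₂.comp M₁)).cls := by
  have hsq := pushHom_square M₃ (M₂.comp M₁)
  rw [comp_i] at hsq
  set v : Hom (pushout M₃ M₂) (pushout M₃ (M₂.comp M₁)) :=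
    pushDesc ((pushHom₁ M₃ (M₂.comp M₁)).comp (pushHom₂ M₂ M₁)) (pushHom₂ M₃ (M₂.comp M₁)) hsq
      with hv
  have h1 : v.comp (pushHom₁ M₃ M₂) = (pushHom₁ M₃ (M₂.comp M₁)).comp (pushHom₂ M₂ M₁) :=
    pushDesc_comp_pushHom₁ _ _ _
  have h2 : v.comp (pushHom₂ M₃ M₂) = pushHom₂ M₃ (M₂.comp M₁) := pushDesc_comp_pushHom₂ _ _ _
  refine comp_cls_eq_of_relabel (M₃.comp (M₂.comp M₁)) (assocEquiv M₃ M₂ M₁) ?_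
    ((pushHom₁ M₃ (M₂.comp M₁)).comp (pushHom₁ M₂ M₁)) v ?_ ?_ ?_ ?_ rfl
  · rintro (b | b | c) <;> rfl
  · have := congrArg (Hom.comp (pushHom₁ M₃ (M₂.comp M₁))) (pushHom_square M₂ M₁)
    exact this.trans (congrArg (fun φ => Hom.comp φ M₂.f) h1).symm
  · intro b
    have e1 := pushInl_new M₂ M₁ b.1 b.2
    exact ((congrArg (pushInl M₃ (M₂.comp M₁)) e1).trans
      (pushInl_new M₃ (M₂.comp M₁) (Sum.inl b : PushGen M₂ M₁) _)).symm
  · rintro (b | c)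
    · refine (Eq.trans (pushDesc_inl _ _ hsq b) ?_).symm
      have e1 := pushInr_gen M₂ M₁ b.1
      exact (congrArg (pushInl M₃ (M₂.comp M₁)) e1).trans
        (pushInl_new M₃ (M₂.comp M₁) (Sum.inr b.1 : PushGen M₂ M₁) _)
    · exact (Eq.trans (pushDesc_inr _ _ hsq c) (pushInr_gen _ _ c)).symm
  · rw [comp_i M₃ M₂, comp_i M₃ (M₂.comp M₁), ← h2]; rfl

/-! ### Stabilizing the factors of a composition -/

/-- The pairs adjoined to `B₂` survive unchanged, so up to rebracketing the push-out is stabilized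
by the same pairs. -/
theorem cls_stab_comp (M₂ : ImmersedMap A₂ A₃) (M₁ : ImmersedMap A₁ A₂) (J : Type u)
    (hJ : Finite J) (c : J → ZMod ρ) :
    ((M₂.stab J hJ c).comp M₁).cls = (M₂.comp M₁).cls := by
  rw [← (M₂.comp M₁).cls_stab J hJ c]
  set s := (pushout M₂ M₁).toStab J hJ c
  let z : J → Free ((pushout M₂ M₁).stab J hJ c).G :=
    fun j => gen (Sum.inr (Sum.inl j) : StabGen (PushGen M₂ M₁) J)
  have hz : ∀ j, z j ∈ homog ((pushout M₂ M₁).stab J hJ c).deg (c j) :=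
    fun j => gen_mem_homog ((pushout M₂ M₁).stab J hJ c).deg
      (Sum.inr (Sum.inl j) : StabGen (PushGen M₂ M₁) J)
  have hv := TriDGA.stabDesc_comp_toStab J hJ c (s.comp (pushHom₂ M₂ M₁)) z hz
  set v := TriDGA.stabDesc J hJ c (s.comp (pushHom₂ M₂ M₁)) z hz
  refine comp_cls_eq_of_relabel ((M₂.comp M₁).stab J hJ c) (Equiv.sumAssoc _ _ _).symm ?_
    (s.comp (pushHom₁ M₂ M₁)) v ?_ ?_ ?_ ?_ rfl
  · rintro (b | b | j | j) <;> rfl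
  · refine (congrArg s.comp (pushHom_square M₂ M₁)).trans ?_
    exact (congrArg (fun φ => Hom.comp φ M₂.f) hv).symm
  · intro b
    refine Eq.symm ((congrArg s.toAlgHom (pushInl_new M₂ M₁ b.1 b.2)).trans ?_)
    exact rename_gen _ _
  · rintro (x | j | j)
    · refine Eq.symm ((TriDGA.stabAlg_inl J _ z x).trans ?_)
      exact (congrArg s.toAlgHom (pushInr_gen M₂ M₁ x)).trans (rename_gen _ _)
    · exact (TriDGA.stabAlg_fst J _ z j).symm
    · exact ((TriDGA.stabAlg_snd J _ z j).trans (TriDGA.stab_d_fst _ J hJ c j)).symm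
  · rw [ImmersedMap.stab_i, ImmersedMap.stab_i, comp_i]
    exact congrArg (fun φ => Hom.comp φ M₂.i) hv

/-- The bijection between the generators of the push-out with a stabilized first factor and those
of the stabilized push-out. -/
def pushStabEquiv (M₂ : ImmersedMap A₂ A₃) (M₁ : ImmersedMap A₁ A₂) (J : Type u)
    (hJ : Finite J) (c : J → ZMod ρ) :
    PushGen M₂ (M₁.stab J hJ c) ≃ StabGen (PushGen M₂ M₁) J where
  toFun := Sum.elim
    (fun x => match x with
      | ⟨Sum.inl b, h⟩ => Sum.inl (Sum.inl ⟨b, fun ⟨a, ha⟩ => h ⟨a, congrArg Sum.inl ha⟩⟩)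
      | ⟨Sum.inr j, _⟩ => Sum.inr j)
    (fun y => Sum.inl (Sum.inr y))
  invFun := Sum.elim
    (Sum.elim (fun b => Sum.inl ⟨(Sum.inl b.1 : StabGen M₁.B.G J), fun ⟨a, ha⟩ =>
      b.2 ⟨a, Sum.inl_injective ha⟩⟩) (fun y => Sum.inr y))
    (fun j => Sum.inl ⟨(Sum.inr j : StabGen M₁.B.G J), fun ⟨_, ha⟩ => Sum.inl_ne_inr ha⟩)
  left_inv := by rintro (⟨b | b, h⟩ | c) <;> rfl
  right_inv := by rintro ((b | b) | c) <;> rfl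

/-- The pairs adjoined to `B₁` do not come from `A₂`, so they persist in the push-out and stabilize
it. -/
theorem cls_comp_stab (M₂ : ImmersedMap A₂ A₃) (M₁ : ImmersedMap A₁ A₂) (J : Type u)
    (hJ : Finite J) (c : J → ZMod ρ) :
    (M₂.comp (M₁.stab J hJ c)).cls = (M₂.comp M₁).cls := by
  rw [← (M₂.comp M₁).cls_stab J hJ c]
  set s := (pushout M₂ M₁).toStab J hJ c
  let z : J → Free ((pushout M₂ M₁).stab J hJ c).G :=
    fun j => gen (Sum.inr (Sum.inl j) : StabGen (PushGen M₂ M₁) J)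
  have hz : ∀ j, z j ∈ homog ((pushout M₂ M₁).stab J hJ c).deg (c j) :=
    fun j => gen_mem_homog ((pushout M₂ M₁).stab J hJ c).deg
      (Sum.inr (Sum.inl j) : StabGen (PushGen M₂ M₁) J)
  have hu := TriDGA.stabDesc_comp_toStab J hJ c (s.comp (pushHom₁ M₂ M₁)) z hz
  set u := TriDGA.stabDesc J hJ c (s.comp (pushHom₁ M₂ M₁)) z hz
  refine comp_cls_eq_of_relabel ((M₂.comp M₁).stab J hJ c) (pushStabEquiv M₂ M₁ J hJ c) ?_
    u (s.comp (pushHom₂ M₂ M₁)) ?_ ?_ ?_ ?_ ?_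
  · rintro (⟨b | j | j, h⟩ | y) <;> rfl
  · rw [ImmersedMap.stab_i]
    refine (congrArg (fun φ => Hom.comp φ M₁.i) hu).trans ?_
    exact congrArg s.comp (pushHom_square M₂ M₁)
  · rintro ⟨b | j | j, h⟩
    · refine Eq.symm ((TriDGA.stabAlg_inl J _ z b).trans ?_)
      exact (congrArg s.toAlgHom (pushInl_new M₂ M₁ b _)).trans (rename_gen _ _)
    · exact (TriDGA.stabAlg_fst J _ z j).symm
    · exact ((TriDGA.stabAlg_snd J _ z j).trans (TriDGA.stab_d_fst _ J hJ c j)).symm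
  · intro y
    exact Eq.symm ((congrArg s.toAlgHom (pushInr_gen M₂ M₁ y)).trans (rename_gen _ _))
  · rw [ImmersedMap.stab_i, comp_i]; rfl
  · exact congrArg (fun φ => Hom.comp φ M₁.f) hu

end Pushout

section Congruence

variable {ρ : ℕ} {A₁ A₂ A₃ : TriDGA.{u} ρ}

/-! ### Varying the second factor of a composition -/

/-- All of `B₂` consists of generators of the push-out, so its tame isomorphism extends by the
identity on the new generators of `B₁`; `φ f₂ = f₂'` makes this a chain map. -/
theorem cls_comp_congr_left_of_isTameIso (M₁ : ImmersedMap A₁ A₂) (M₂ M₂' : ImmersedMap A₂ A₃)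
    (φ : Hom M₂.B M₂'.B) (hφ : φ.IsTameIso) (hi : φ.comp M₂.i = M₂'.i)
    (hf : φ.comp M₂.f = M₂'.f) : (M₂.comp M₁).cls = (M₂'.comp M₁).cls := by
  obtain ⟨e, he, hφe⟩ := hφ
  obtain ⟨E, hE, hEr, hEl⟩ :=
    he.exists_extend (fun b : {b : M₁.B.G // b ∉ Set.range M₁.incl} => M₁.B.deg b.1)
  have hsq := pushHom_square M₂' M₁
  rw [← hf] at hsq
  refine comp_cls_eq (M₂'.comp M₁) E hE (pushHom₁ M₂' M₁) ((pushHom₂ M₂' M₁).comp φ) hsq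
    (fun b => (hEl b).trans (pushInl_new M₂' M₁ b.1 b.2).symm) (fun c => ?_) ?_
    (Homotopic.refl _)
  · have := hEr (gen c)
    rw [rename_gen] at this
    exact this.trans (congrArg (rename Sum.inr) (DFunLike.congr_fun hφe (gen c)).symm)
  · exact (congrArg (pushHom₂ M₂' M₁).comp hi).trans (comp_i M₂' M₁).symm

/-- A derivation out of a triangular DGA into a filtered free algebra respects the filtration on
the differentials of the generators. -/
theorem TriDGA.derivation_d_mem_subalg (B : TriDGA.{u} ρ) {r : B.G → ℕ}
    (ht : ∀ x, B.d (gen x) ∈ subalg {y | r y < r x}) {G : Type u}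
    {f g : Free B.G →ₐ[ZMod 2] Free G} {K : Free B.G →ₗ[ZMod 2] Free G}
    (hK : ∀ p q, K (p * q) = K p * g q + f p * K q) (R : G → ℕ) (m : ℕ)
    (hf : ∀ x, K (B.d (gen x)) ∈ subalg {y | R y < m + r x} →
      f (gen x) ∈ subalg {y | R y < m + r x + 1})
    (hg : ∀ x, g (gen x) ∈ subalg {y | R y < m + r x + 1})
    (hk : ∀ x, K (gen x) ∈ subalg {y | R y < m + r x + 1}) (x : B.G) :
    K (B.d (gen x)) ∈ subalg {y | R y < m + r x} := by
  -- The bounds on `f x` and on `K (∂x)` depend on each other. Induction on rank breaks the circle: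
  -- the bound for `K (∂x)` uses `f y` only for earlier `y`.
  suffices h : ∀ n x, r x = n → K (B.d (gen x)) ∈ subalg {y | R y < m + r x} from h _ x rfl
  intro n
  induction n using Nat.strong_induction_on with
  | _ n ih =>
    intro x hx
    have hmono : ∀ y, r y < r x → ∀ p ∈ subalg {z | R z < m + r y + 1},
        p ∈ subalg {z | R z < m + r x} := by
      intro y hy p hp
      refine subalg_mono (fun z hz => ?_) hp
      simp only [Set.mem_ofPred_eq] at hz ⊢
      omega
    refine derivation_mem_subalgebra hK (fun y hy => ?_) (ht x)
    have hy' : r y < r x := hy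
    exact ⟨hmono y hy' _ (hf y (ih (r y) (hx ▸ hy') y rfl)), hmono y hy' _ (hg y),
      hmono y hy' _ (hk y)⟩

/-- In the push-out along `g` the map `p₁` restricts to `p₂ g ≃ p₂ f₂` on `A₂`. Homotopy extension
deforms it to a map that is compatible with `f₂`, hence defines a map out of the push-out along
`f₂`; its shape on the new generators makes it tame. -/
theorem cls_comp_congr_left_of_homotopic (M₁ : ImmersedMap A₁ A₂) (M₂ : ImmersedMap A₂ A₃)
    (g : Hom A₂ M₂.B) (H : Homotopic M₂.f g) :
    (M₂.comp M₁).cls = ((M₂.withMap g).comp M₁).cls := by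
  set M₂' := M₂.withMap g with hM₂'
  set P := pushout M₂' M₁ with hP
  set p₁ : Hom M₁.B P := pushHom₁ M₂' M₁ with hp₁
  set p₂ : Hom M₂.B P := pushHom₂ M₂' M₁ with hp₂
  have hsq : p₁.comp M₁.i = p₂.comp g := pushHom_square M₂' M₁
  have hsq' : ∀ p, p₁.toAlgHom (M₁.i.toAlgHom p) = p₂.toAlgHom (g.toAlgHom p) := fun p =>
    congrArg (fun φ : Hom A₂ P => φ.toAlgHom p) hsq
  obtain ⟨H, H1, H2, H3⟩ := H
  obtain ⟨f, K, hf, hfd, hfi, hKgr, hK, hh, hKi, hKn⟩ := M₁.exists_extension_left P.d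
    (homog P.deg) P.d_mul P.d_d (g := p₁.toAlgHom)
    (fun x => p₁.map_homog _ _ (gen_mem_homog _ x)) p₁.map_d
    (f₀ := (p₂.comp M₂.f).toAlgHom) (fun x => (p₂.comp M₂.f).map_homog _ _ (gen_mem_homog _ x))
    (H := p₂.toAlgHom.toLinearMap ∘ₗ H) (fun x => p₂.map_homog _ _ (H1 _ _ (gen_mem_homog _ x)))
    (fun p q => by
      rw [hsq', LinearMap.comp_apply, H2]
      exact (map_add p₂.toAlgHom _ _).trans
        (congrArg₂ _ (map_mul p₂.toAlgHom _ _) (map_mul p₂.toAlgHom _ _)))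
    (fun p => by
      rw [hsq', LinearMap.comp_apply, LinearMap.comp_apply]
      refine (map_sub p₂.toAlgHom _ _).symm.trans ((congrArg p₂.toAlgHom (H3 p)).trans ?_)
      rw [map_add, p₂.map_d]
      rfl)
  let u : Hom M₁.B P :=
    ⟨f, fun n p hp => map_mem_graded (homog P.deg) hf hp, hfd⟩
  have hu : Homotopic u p₁ := ⟨K, fun n p hp => derivation_mem_graded (homog P.deg) hK hf
    (fun x => p₁.map_homog _ _ (gen_mem_homog _ x)) hKgr hp, hK, hh⟩
  have huv : u.comp M₁.i = p₂.comp M₂.f := Hom.ext hfi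
  obtain ⟨r₁, hr₁, ht₁⟩ := M₁.B.triangular
  obtain ⟨r₂, hr₂, -⟩ := M₂.B.triangular
  have hfin := M₂.B.finite
  obtain ⟨N, hN⟩ : ∃ N, ∀ x, r₂ x < N := by
    obtain ⟨N, hN⟩ := (Set.finite_range r₂).bddAbove
    exact ⟨N + 1, fun x => Nat.lt_succ_of_le (hN ⟨x, rfl⟩)⟩
  -- The new generators of `B₁` rank above all of `B₂`, so everything in the image of `p₂` is
  -- admissible as a correction term.
  set R : PushGen M₂ M₁ → ℕ := Sum.elim (fun b => N + r₁ b.1) r₂ with hR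
  have hRinj : Function.Injective R := by
    rintro (b | c) (b' | c') h <;> simp only [hR, Sum.elim_inl, Sum.elim_inr] at h
    · rw [Subtype.ext (hr₁ (by omega : r₁ b.1 = r₁ b'.1))]
    · have := hN c'; omega
    · have := hN c; omega
    · rw [hr₂ h]
  have hp₂R : ∀ m, N ≤ m → ∀ p, p₂.toAlgHom p ∈ subalg {y : PushGen M₂ M₁ | R y < m} :=
    fun m hm p => rename_mem_subalg (fun c => (hN c).trans_le hm) p
  have hp₁R : ∀ b, p₁.toAlgHom (gen b) ∈ subalg {y : PushGen M₂ M₁ | R y < N + r₁ b + 1} := by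
    intro b
    by_cases hb : b ∈ Set.range M₁.incl
    · obtain ⟨a, rfl⟩ := hb
      rw [← M₁.i_gen, hsq']
      exact hp₂R _ (by omega) _
    · have e1 : p₁.toAlgHom (gen b) = gen (Sum.inl ⟨b, hb⟩ : PushGen M₂ M₁) :=
        pushInl_new M₂' M₁ b hb
      rw [e1]
      exact gen_mem_subalg (Nat.lt_succ_self (N + r₁ b))
  -- This is where the vanishing of `K` on new generators matters: the correction to `p₁ b` is `K
  -- (∂b)` alone, with no term `∂(K b)` that could leave the filtration.
  have hnew : ∀ b, b ∉ Set.range M₁.incl →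
      f (gen b) = p₁.toAlgHom (gen b) + K (M₁.B.d (gen b)) := by
    intro b hb
    have := hh (gen b)
    rw [hKn b hb, map_zero, zero_add, sub_eq_iff_eq_add'] at this
    exact this
  have hKd : ∀ b, K (M₁.B.d (gen b)) ∈ subalg {y : PushGen M₂ M₁ | R y < N + r₁ b} := by
    refine M₁.B.derivation_d_mem_subalg ht₁ hK R N (fun b hb => ?_) hp₁R (fun b => ?_)
    · by_cases hb' : b ∈ Set.range M₁.incl
      · obtain ⟨a, rfl⟩ := hb'
        have e1 := DFunLike.congr_fun hfi (gen a)
        rw [AlgHom.comp_apply, M₁.i_gen] at e1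
        rw [e1]
        exact hp₂R _ (by omega) _
      · rw [hnew b hb']
        refine add_mem (hp₁R b) (subalg_mono (fun z hz => ?_) hb)
        exact Nat.lt_succ_of_lt hz
    · by_cases hb' : b ∈ Set.range M₁.incl
      · obtain ⟨a, rfl⟩ := hb'
        rw [hKi]
        exact hp₂R _ (by omega) _
      · rw [hKn b hb']; exact zero_mem _
  have hPfin : Finite (PushGen M₂ M₁) := P.finite
  obtain ⟨e, he, hew⟩ := exists_tame_triangular (pushDeg M₂ M₁)
    (Sum.elim (fun b => K (M₁.B.d (gen b.1))) (fun _ => 0))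
    (by
      rintro (b | c)
      · have := derivation_mem_graded (homog P.deg) hK hf
          (fun x => p₁.map_homog _ _ (gen_mem_homog _ x)) hKgr
          (M₁.B.d_homog _ _ (gen_mem_homog _ b.1))
        rw [sub_add_cancel] at this
        exact this
      · exact zero_mem _)
    R hRinj
    (by
      rintro (b | c)
      · exact hKd b.1
      · exact zero_mem _)
  refine comp_cls_eq (M₂'.comp M₁) e he u p₂ huv (fun b => ?_) (fun c => ?_) ?_ (hu.comp_right _)
  · refine (hew (Sum.inl b)).trans (Eq.trans ?_ (hnew b.1 b.2).symm)
    exact congrArg (· + K (M₁.B.d (gen b.1))) (pushInl_new M₂' M₁ b.1 b.2).symm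
  · exact (hew (Sum.inr c)).trans ((add_zero _).trans (pushInr_gen M₂' M₁ c).symm)
  · exact (comp_i M₂' M₁).symm

theorem cls_comp_congr_left (M₁ : ImmersedMap A₁ A₂) {M₂ M₂' : ImmersedMap A₂ A₃}
    (h : ImmersedHomotopic M₂ M₂') : (M₂.comp M₁).cls = (M₂'.comp M₁).cls :=
  ImmersedMap.eq_of_immersedHomotopic (fun M => (M.comp M₁).cls)
    (fun M J hJ c => cls_stab_comp M M₁ J hJ c)
    (fun M M' φ hφ hi hf => cls_comp_congr_left_of_isTameIso M₁ M M' φ hφ hi hf)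
    (fun M g H => cls_comp_congr_left_of_homotopic M₁ M g H) h

end Congruence

section Congruence

variable {ρ : ℕ} {A₁ A₂ A₃ : TriDGA.{u} ρ}

/-! ### Varying the first factor of a composition -/

/-- The push-out does not depend on `f₁`, so the identity serves and the homotopy is composed with
`p₁`. -/
theorem cls_comp_congr_right_of_homotopic (M₂ : ImmersedMap A₂ A₃) (M₁ : ImmersedMap A₁ A₂)
    (g : Hom A₁ M₁.B) (H : Homotopic M₁.f g) :
    (M₂.comp M₁).cls = (M₂.comp (M₁.withMap g)).cls :=
  comp_cls_eq (M₂.comp (M₁.withMap g)) AlgEquiv.refl (.refl _) (pushHom₁ M₂ M₁) (pushHom₂ M₂ M₁)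
    (pushHom_square M₂ M₁) (fun b => (pushInl_new M₂ M₁ b.1 b.2).symm)
    (fun c => (pushInr_gen M₂ M₁ c).symm) (comp_i M₂ (M₁.withMap g)).symm
    (H.comp_left (pushHom₁ M₂ M₁))

/-- If, up to a tame automorphism, `f₂` is induced by an injection of generators, then tame
isomorphisms of the first factor extend to tame isomorphisms of the push-outs. -/
theorem cls_comp_congr_right_of_coordinates (M₂ : ImmersedMap A₂ A₃) (j : A₂.G ↪ M₂.B.G)
    (hj : ∀ a, A₂.deg a = M₂.B.deg (j a)) (θ : Free M₂.B.G ≃ₐ[ZMod 2] Free M₂.B.G)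
    (hθ : IsTame M₂.B.deg M₂.B.deg θ) (hθj : ∀ a, θ (gen (j a)) = M₂.f.toAlgHom (gen a))
    (M₁ M₁' : ImmersedMap A₁ A₂) (φ : Hom M₁.B M₁'.B) (hφ : φ.IsTameIso)
    (hi : φ.comp M₁.i = M₁'.i) (hf : φ.comp M₁.f = M₁'.f) :
    (M₂.comp M₁).cls = (M₂.comp M₁').cls := by
  obtain ⟨e, he, hφe⟩ := hφ
  have hei : ∀ a, e (gen (M₁.incl a)) = gen (M₁'.incl a) := fun a => by
    rw [← M₁.i_gen, ← M₁'.i_gen, ← hi]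
    exact (DFunLike.congr_fun hφe _).symm
  -- `X` extends `e` by the identity on the generators of `B₂` outside `j`, while `E` and `E'`
  -- extend `θ` by the identity on the new generators of `B₁` and `B₁'`.
  obtain ⟨X, hX, hXr, hXl⟩ :=
    he.exists_extend (fun c : {c : M₂.B.G // c ∉ Set.range j} => M₂.B.deg c.1)
  obtain ⟨E, hE, hEr, hEl⟩ :=
    hθ.exists_extend (fun b : {b : M₁.B.G // b ∉ Set.range M₁.incl} => M₁.B.deg b.1)
  obtain ⟨E', hE', hEr', hEl'⟩ :=
    hθ.exists_extend (fun b : {b : M₁'.B.G // b ∉ Set.range M₁'.incl} => M₁'.B.deg b.1)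
  set σ := amalgamEquiv M₁.incl j with hσ
  set σ' := amalgamEquiv M₁'.incl j with hσ'
  have hR : IsTame _ _ (relabelEquiv σ) :=
    .relabelEquiv σ (amalgamEquiv_deg M₁.incl j (fun a => (M₁.deg_incl a).trans (hj a)))
  have hR' : IsTame _ _ (relabelEquiv σ') :=
    .relabelEquiv σ' (amalgamEquiv_deg M₁'.incl j (fun a => (M₁'.deg_incl a).trans (hj a)))
  -- Identifying `j a` with `i₁ a` turns `X` into a map of push-out generators. It fixes all of
  -- `B₂`, because `e` sends `i₁ a` to `i₁' a`.
  set Y := ((relabelEquiv σ).trans X).trans (relabelEquiv σ').symm with hY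
  have hYr : ∀ q, Y (rename Sum.inr q) = rename Sum.inr q := by
    intro q
    refine DFunLike.congr_fun (?_ : Y.toAlgHom.comp (rename Sum.inr) = rename Sum.inr) q
    refine algHom_ext_gen (fun c => ?_)
    rw [AlgHom.comp_apply, rename_gen, rename_gen]
    change rename σ'.symm (X (rename σ (gen (Sum.inr c)))) = gen (Sum.inr c)
    rw [rename_gen]
    by_cases hc : c ∈ Set.range j
    · obtain ⟨a, rfl⟩ := hc
      have h1 := hXr (gen (M₁.incl a))
      rw [rename_gen, hei, rename_gen] at h1
      rw [hσ, amalgamEquiv_inr_apply, h1, rename_gen, hσ', ← amalgamEquiv_inr_apply M₁'.incl j,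
        Equiv.symm_apply_apply]
    · rw [hσ, amalgamEquiv_inr_new _ j c hc, hXl, rename_gen, hσ',
        ← amalgamEquiv_inr_new M₁'.incl j c hc, Equiv.symm_apply_apply]
  -- Conjugation by `θ` passes from the coordinates in which `f₂` is the injection `j` to the given
  -- ones; `Φ` still fixes `B₂`, since the two copies of `θ` cancel there.
  set Φ := (E.symm.trans Y).trans E' with hΦ
  have hΦtame : IsTame (pushDeg M₂ M₁) (pushDeg M₂ M₁') Φ :=
    (hE.symm.trans ((hR.trans hX).trans hR'.symm)).trans hE'
  have hΦr : ∀ c, Φ (gen (Sum.inr c)) = gen (Sum.inr c) := by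
    intro c
    have h1 : E.symm (gen (Sum.inr c)) = rename Sum.inr (θ.symm (gen c)) := by
      rw [AlgEquiv.symm_apply_eq, hEr, AlgEquiv.apply_symm_apply, rename_gen]
    change E' (Y (E.symm _)) = _
    rw [h1, hYr, hEr', AlgEquiv.apply_symm_apply, rename_gen]
  -- In these coordinates `p₁` is the plain inclusion of `B₁'` followed by `θ`: on `i₁' a` this
  -- gives `θ (j a) = f₂ a`.
  have hpush : ∀ p, E' (rename σ'.symm (rename Sum.inr p)) = pushInl M₂ M₁' p := by
    intro p
    refine DFunLike.congr_fun (?_ : (E'.toAlgHom.comp (rename σ'.symm)).comp (rename Sum.inr) =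
      pushInl M₂ M₁') p
    refine algHom_ext_gen (fun b => ?_)
    rw [AlgHom.comp_apply, AlgHom.comp_apply, rename_gen, rename_gen]
    by_cases hb : b ∈ Set.range M₁'.incl
    · obtain ⟨a, rfl⟩ := hb
      have h1 := hEr' (gen (j a))
      rw [rename_gen, hθj] at h1
      rw [pushInl_incl, hσ', ← amalgamEquiv_inr_apply M₁'.incl j, Equiv.symm_apply_apply]
      exact h1
    · have h1 := amalgamEquiv_inl M₁'.incl j ⟨b, hb⟩
      rw [pushInl_new M₂ M₁' b hb, hσ', ← h1, Equiv.symm_apply_apply]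
      exact hEl' _
  have hΦl : ∀ b, Φ (gen (Sum.inl b)) = pushInl M₂ M₁' (e (gen b.1)) := by
    intro b
    have h1 : E.symm (gen (Sum.inl b)) = gen (Sum.inl b) := by
      rw [AlgEquiv.symm_apply_eq, hEl]
    have h2 := hXr (gen b.1)
    rw [rename_gen] at h2
    change E' (rename σ'.symm (X (rename σ (E.symm _)))) = _
    rw [h1, rename_gen, hσ, amalgamEquiv_inl, h2, hpush]
  have hsq := pushHom_square M₂ M₁'
  rw [← hi] at hsq
  refine comp_cls_eq (M₂.comp M₁') Φ hΦtame ((pushHom₁ M₂ M₁').comp φ) (pushHom₂ M₂ M₁') hsq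
    (fun b => ?_) (fun c => (hΦr c).trans (pushInr_gen M₂ M₁' c).symm) (comp_i M₂ M₁').symm ?_
  · exact (hΦl b).trans (congrArg (pushInl M₂ M₁') (DFunLike.congr_fun hφe (gen b.1)).symm)
  · have : ((pushHom₁ M₂ M₁').comp φ).comp M₁.f = (M₂.comp M₁').f :=
      congrArg (pushHom₁ M₂ M₁').comp hf
    exact this ▸ Homotopic.refl _

/-- Every immersed map is equivalent to one whose map `f` is induced by an injection of generators
up to a tame automorphism: this is the mapping cylinder construction. -/
theorem exists_coordinates (M : ImmersedMap A₁ A₂) :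
    ∃ (M' : ImmersedMap A₁ A₂) (j : A₁.G ↪ M'.B.G) (θ : Free M'.B.G ≃ₐ[ZMod 2] Free M'.B.G),
      (∀ (A₀ : TriDGA.{u} ρ) (M₀ : ImmersedMap A₀ A₁), (M.comp M₀).cls = (M'.comp M₀).cls) ∧
      (∀ a, A₁.deg a = M'.B.deg (j a)) ∧ IsTame M'.B.deg M'.B.deg θ ∧
      ∀ a, θ (gen (j a)) = M'.f.toAlgHom (gen a) := by
  -- The pair `a_x, b_x` attached to a generator `x` of `A₁` has degrees `|x| + 1` and `|x|`, so
  -- `a_x` can be a value of a homotopy and `b_x` can serve as a coordinate for `x`.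
  set c : A₁.G → ZMod ρ := fun a => A₁.deg a + 1 with hc
  set S := M.B.stab A₁.G A₁.finite c with hS
  set g : Hom A₁ S := (M.B.toStab A₁.G A₁.finite c).comp M.f with hg
  set k : A₁.G → Free S.G :=
    fun a => gen (Sum.inr (Sum.inl a) : StabGen M.B.G A₁.G) with hk
  have hkgr : ∀ a, k a ∈ homog S.deg (A₁.deg a + 1) := fun a =>
    gen_mem_homog S.deg (Sum.inr (Sum.inl a) : StabGen M.B.G A₁.G)
  -- Deforming along `K x = a_x` gives `f x = b_x + g x + K (∂x)`.
  obtain ⟨f, hfg, hf⟩ := g.exists_homotopic k hkgr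
  have hSd : ∀ a, S.d (k a) = gen (Sum.inr (Sum.inr a) : StabGen M.B.G A₁.G) :=
    fun a => M.B.stab_d_fst A₁.G A₁.finite c a
  set M' := (M.stab A₁.G A₁.finite c).withMap f with hM'
  obtain ⟨r₁, hr₁, ht₁⟩ := A₁.triangular
  obtain ⟨r₂, hr₂, -⟩ := M.B.triangular
  have hfin₁ := A₁.finite
  have hfin₂ := M.B.finite
  obtain ⟨N₁, hN₁⟩ : ∃ N, ∀ x, r₁ x < N := by
    obtain ⟨N, hN⟩ := (Set.finite_range r₁).bddAbove
    exact ⟨N + 1, fun x => Nat.lt_succ_of_le (hN ⟨x, rfl⟩)⟩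
  obtain ⟨N₂, hN₂⟩ : ∃ N, ∀ x, r₂ x < N := by
    obtain ⟨N, hN⟩ := (Set.finite_range r₂).bddAbove
    exact ⟨N + 1, fun x => Nat.lt_succ_of_le (hN ⟨x, rfl⟩)⟩
  -- The order is `B`, then the `a_x`, then the `b_x` in the order of `A₁`. Thus `K (∂x)` lies below
  -- `b_x`, although it may contain any of the earlier `a_y` and `b_y`.
  set R : StabGen M.B.G A₁.G → ℕ :=
    Sum.elim r₂ (Sum.elim (fun a => N₂ + r₁ a) (fun a => N₂ + N₁ + r₁ a)) with hR
  have hRinj : Function.Injective R := by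
    rintro (x | a | a) (y | b | b) h <;> simp only [hR, Sum.elim_inl, Sum.elim_inr] at h
    · rw [hr₂ h]
    · have := hN₂ x; omega
    · have := hN₂ x; omega
    · have := hN₂ y; omega
    · rw [hr₁ (by omega : r₁ a = r₁ b)]
    · have := hN₁ a; omega
    · have := hN₂ y; omega
    · have := hN₁ b; omega
    · rw [hr₁ (by omega : r₁ a = r₁ b)]
  have hgR : ∀ m, N₂ ≤ m → ∀ p, g.toAlgHom p ∈ subalg {y : StabGen M.B.G A₁.G | R y < m} :=
    fun m hm p => rename_mem_subalg (fun x => (hN₂ x).trans_le hm) (M.f.toAlgHom p)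
  set K := tder f.toAlgHom g.toAlgHom k with hK
  have hKm := tder_mul f.toAlgHom g.toAlgHom k
  have hKd : ∀ a, K (A₁.d (gen a)) ∈
      subalg {y : StabGen M.B.G A₁.G | R y < N₂ + N₁ + r₁ a} := by
    refine A₁.derivation_d_mem_subalg ht₁ hKm R (N₂ + N₁) (fun a ha => ?_)
      (fun a => hgR _ (by omega) _) (fun a => ?_)
    · rw [hf, hSd]
      refine add_mem (add_mem (hgR _ (by omega) _) (gen_mem_subalg ?_)) (subalg_mono ?_ ha)
      · exact Nat.lt_succ_self (N₂ + N₁ + r₁ a)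
      · exact fun z hz => Nat.lt_succ_of_lt hz
    · rw [tder_gen]
      refine gen_mem_subalg (?_ : N₂ + r₁ a < N₂ + N₁ + r₁ a + 1)
      omega
  have hSfin : Finite (StabGen M.B.G A₁.G) := S.finite
  -- `θ` adds `g x + K (∂x)` to `b_x` and fixes the other generators, so it takes the injection `x ↦
  -- b_x` to `f`.
  obtain ⟨θ, hθ, hθw⟩ := exists_tame_triangular (G := StabGen M.B.G A₁.G) S.deg
    (Sum.elim (fun _ => 0) (Sum.elim (fun _ => 0)
      (fun a => g.toAlgHom (gen a) + K (A₁.d (gen a)))))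
    (by
      rintro (x | a | a)
      · exact zero_mem _
      · exact zero_mem _
      · have h1 : S.deg (Sum.inr (Sum.inr a) : StabGen M.B.G A₁.G) = A₁.deg a :=
          add_sub_cancel_right _ _
        refine h1.symm ▸ add_mem (g.map_homog _ _ (gen_mem_homog _ a)) ?_
        have := derivation_mem_graded (homog S.deg) hKm
          (fun x => f.map_homog _ _ (gen_mem_homog _ x))
          (fun x => g.map_homog _ _ (gen_mem_homog _ x)) (by simpa using hkgr)
          (A₁.d_homog _ _ (gen_mem_homog _ a))
        rwa [sub_add_cancel] at this)
    R hRinj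
    (by
      rintro (x | a | a)
      · exact zero_mem _
      · exact zero_mem _
      · exact add_mem (hgR _ (by simp only [hR, Sum.elim_inr]; omega) _) (hKd a))
  refine ⟨M', ⟨fun a => (Sum.inr (Sum.inr a) : StabGen M.B.G A₁.G), fun a b h => ?_⟩, θ,
    fun A₀ M₀ => ?_, fun a => (add_sub_cancel_right _ _).symm, hθ, fun a => ?_⟩
  · exact Sum.inr_injective (Sum.inr_injective h)
  · rw [← cls_stab_comp M M₀ A₁.G A₁.finite c]
    exact (cls_comp_congr_left_of_homotopic M₀ M' g hfg).symm
  · refine (hθw (Sum.inr (Sum.inr a))).trans ((hf a).trans ?_).symm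
    rw [hSd]
    change _ = _ + (g.toAlgHom (gen a) + K (A₁.d (gen a)))
    abel

/-- Only the tame isomorphism move needs `M₂` in good coordinates. Replacing `M₂` by its mapping
cylinder is legitimate because it is already known not to change the class of a composition. -/
theorem cls_comp_congr_right (M₂ : ImmersedMap A₂ A₃) {M₁ M₁' : ImmersedMap A₁ A₂}
    (h : ImmersedHomotopic M₁ M₁') : (M₂.comp M₁).cls = (M₂.comp M₁').cls := by
  refine ImmersedMap.eq_of_immersedHomotopic (fun M => (M₂.comp M).cls)
    (fun M J hJ c => cls_comp_stab M₂ M J hJ c) (fun M M' φ hφ hi hf => ?_)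
    (fun M g H => cls_comp_congr_right_of_homotopic M₂ M g H) h
  obtain ⟨M₂', j, θ, hM₂', hj, hθ, hθj⟩ := exists_coordinates M₂
  simp only [hM₂']
  exact cls_comp_congr_right_of_coordinates M₂' j hj θ hθ hθj M M' φ hφ hi hf

/-- Immersed homotopy classes form a category. -/
theorem isCategory (ρ : ℕ) : IsCategory.{u} ρ where
  comp_congr {A₁ A₂ A₃} M₂ M₂' M₁ M₁' h₂ h₁ := by
    have e1 : (M₂.comp M₁).cls = (M₂'.comp M₁).cls :=
      congrArg (Quot.lift (fun M : ImmersedMap A₂ A₃ => (M.comp M₁).cls)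
        (fun _ _ h => cls_comp_congr_left M₁ h)) h₂
    have e2 : (M₂'.comp M₁).cls = (M₂'.comp M₁').cls :=
      congrArg (Quot.lift (fun M : ImmersedMap A₁ A₂ => (M₂'.comp M).cls)
        (fun _ _ h => cls_comp_congr_right M₂' h)) h₁
    exact e1.trans e2
  comp_id := cls_comp_id
  id_comp := cls_id_comp
  assoc := cls_assoc

end Congruence

section Augmentations

variable {ρ : ℕ} {A A₁ A₂ A₃ B C : TriDGA.{u} ρ}

/-! ### Pullbacks of augmentation classes -/

theorem AugClass.pullback_comp (g : Hom B C) (f : Hom A B) (α : AugClass C) :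
    AugClass.pullback (g.comp f) α = AugClass.pullback f (AugClass.pullback g α) := by
  induction α using Quot.ind; rfl

theorem AugClass.pullback_id (α : AugClass A) : AugClass.pullback (Hom.id A) α = α := by
  induction α using Quot.ind; rfl

theorem AugClass.pullback_eq_of_homotopic {f g : Hom A B} (H : Homotopic f g) (α : AugClass B) :
    AugClass.pullback f α = AugClass.pullback g α := by
  induction α using Quot.ind with
  | mk ε =>
    obtain ⟨K, h1, h2, h3⟩ := H
    refine Quot.sound ⟨ε.toAlgHom.toLinearMap ∘ₗ K,
      fun k p hp => ε.map_homog _ _ (h1 k p hp), fun p q => ?_, fun p => ?_⟩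
    · simp [h2, Aug.pullback]
    · have := congrArg ε.toAlgHom (h3 p)
      rw [map_sub, map_add, ε.map_d, zero_add] at this
      exact this

/-! ### Homotopy invariance of the induced augmentation set -/

/-- Pullback along the inclusion into the stabilization is onto on classes: the retraction extends
any augmentation by zero on the added pairs. -/
theorem ImmersedMap.augSet_stab (M : ImmersedMap A₁ A₂) (J : Type u) (hJ : Finite J)
    (c : J → ZMod ρ) : (M.stab J hJ c).augSet = M.augSet := by
  have h : ∀ α : AugClass (M.B.stab J hJ c),
      (AugClass.pullback (M.stab J hJ c).i α, AugClass.pullback (M.stab J hJ c).f α) =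
      (AugClass.pullback M.i (AugClass.pullback (M.B.toStab J hJ c) α),
        AugClass.pullback M.f (AugClass.pullback (M.B.toStab J hJ c) α)) := fun α => by
    rw [M.stab_i, ← AugClass.pullback_comp, ← AugClass.pullback_comp]; rfl
  refine Set.Subset.antisymm ?_ ?_
  · rintro _ ⟨α, rfl⟩
    exact ⟨_, (h α).symm⟩
  · rintro _ ⟨α, rfl⟩
    have hr : AugClass.pullback (M.B.toStab J hJ c)
        (AugClass.pullback (M.B.retract J hJ c) α) = α := by
      rw [← AugClass.pullback_comp, M.B.retract_comp_toStab, AugClass.pullback_id]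
    exact ⟨AugClass.pullback (M.B.retract J hJ c) α, (h _).trans
      (congrArg (fun β => (AugClass.pullback M.i β, AugClass.pullback M.f β)) hr)⟩

theorem ImmersedMap.augSet_eq_of_isTameIso (M M' : ImmersedMap A₁ A₂) (φ : Hom M.B M'.B)
    (hφ : φ.IsTameIso) (hi : φ.comp M.i = M'.i) (hf : φ.comp M.f = M'.f) :
    M.augSet = M'.augSet := by
  obtain ⟨ψ, hψ, -⟩ := hφ.exists_inv
  have h : ∀ α, (AugClass.pullback M'.i α, AugClass.pullback M'.f α) =
      (AugClass.pullback M.i (AugClass.pullback φ α),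
        AugClass.pullback M.f (AugClass.pullback φ α)) := fun α => by
    rw [← hi, ← hf, AugClass.pullback_comp, AugClass.pullback_comp]
  refine Set.Subset.antisymm ?_ ?_
  · rintro _ ⟨α, rfl⟩
    refine ⟨AugClass.pullback ψ α, (h _).trans ?_⟩
    rw [← AugClass.pullback_comp ψ φ, hψ, AugClass.pullback_id]
  · rintro _ ⟨α, rfl⟩
    exact ⟨_, (h α).symm⟩

theorem ImmersedMap.augSet_eq_of_immersedHomotopic {M M' : ImmersedMap A₁ A₂}
    (h : ImmersedHomotopic M M') : M.augSet = M'.augSet :=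
  ImmersedMap.eq_of_immersedHomotopic ImmersedMap.augSet ImmersedMap.augSet_stab
    ImmersedMap.augSet_eq_of_isTameIso
    (fun _ _ H => congrArg Set.range (funext fun α =>
      Prod.ext rfl (AugClass.pullback_eq_of_homotopic H α))) h

/-- The induced augmentation set of an immersed homotopy class. -/
def ImHom.augSet (m : ImHom A₁ A₂) : SetRel (AugClass A₂) (AugClass A₁) :=
  Quot.lift ImmersedMap.augSet (fun _ _ h => ImmersedMap.augSet_eq_of_immersedHomotopic h) m

theorem ImmersedMap.augSet_eq_of_cls_eq {M M' : ImmersedMap A₁ A₂} (h : M.cls = M'.cls) :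
    M.augSet = M'.augSet :=
  congrArg ImHom.augSet h

/-! ### Extending homotopies of augmentations -/

/-- The grading of `ℤ/2`, concentrated in degree `0`. -/
def pointGrading (ρ : ℕ) (n : ZMod ρ) : Submodule (ZMod 2) (ZMod 2) where
  carrier := {a | a ≠ 0 → n = 0}
  zero_mem' h := absurd rfl h
  add_mem' {a b} ha hb h := by
    by_cases h' : a = 0
    · exact hb (fun hb' => h (by rw [h', hb', add_zero]))
    · exact ha h'
  smul_mem' c a ha h := ha (fun h' => h (by rw [h', smul_zero]))

instance pointGrading_gradedMonoid (ρ : ℕ) : SetLike.GradedMonoid (pointGrading ρ) where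
  one_mem _ := rfl
  mul_mem i j a b ha hb h := by
    rw [ha (left_ne_zero_of_mul h), hb (right_ne_zero_of_mul h), add_zero]

/-- An augmentation from an algebra map that is graded on the generators. -/
def Aug.ofGraded (f : Free A.G →ₐ[ZMod 2] ZMod 2)
    (hf : ∀ x, f (gen x) ∈ pointGrading ρ (A.deg x)) (hd : ∀ p, f (A.d p) = 0) : Aug A where
  toAlgHom := f
  map_homog _ _ hp := map_mem_graded (pointGrading ρ) hf hp
  map_d := hd

theorem Aug.gen_mem (ε : Aug A) (x : A.G) : ε.toAlgHom (gen x) ∈ pointGrading ρ (A.deg x) :=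
  ε.map_homog _ _ (gen_mem_homog _ x)

/-- This is homotopy extension with target `ℤ/2`, concentrated in degree `0` and with zero
differential. -/
theorem AugHomotopic.exists_extension_left (M : ImmersedMap A₁ A₂) (α : Aug M.B) {ε : Aug A₂}
    (h : AugHomotopic ε (α.pullback M.i)) :
    ∃ α' : Aug M.B, AugHomotopic α' α ∧ α'.pullback M.i = ε := by
  obtain ⟨H, H1, H2, H3⟩ := h
  obtain ⟨f, K, hf, hfd, hfi, hKgr, hK, hh, -⟩ := M.exists_extension_left 0 (pointGrading ρ)
    (by simp) (by simp) α.gen_mem α.map_d ε.gen_mem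
    (fun x => H1 _ _ (gen_mem_homog _ x)) H2 (fun p => (H3 p).trans (by simp))
  exact ⟨Aug.ofGraded f hf hfd, ⟨K, fun k p hp =>
    derivation_mem_graded (pointGrading ρ) hK hf α.gen_mem hKgr hp, hK,
    fun p => (hh p).trans (by simp)⟩, Aug.ext hfi⟩

theorem AugHomotopic.exists_extension_right (M : ImmersedMap A₁ A₂) (α : Aug M.B) {ε : Aug A₂}
    (h : AugHomotopic (α.pullback M.i) ε) :
    ∃ α' : Aug M.B, AugHomotopic α α' ∧ α'.pullback M.i = ε := by
  obtain ⟨H, H1, H2, H3⟩ := h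
  obtain ⟨g, K, hg, hgd, hgi, hKgr, hK, hh⟩ := M.exists_extension_right 0 (pointGrading ρ)
    (by simp) (by simp) α.gen_mem α.map_d ε.gen_mem
    (fun x => H1 _ _ (gen_mem_homog _ x)) H2 (fun p => (H3 p).trans (by simp))
  exact ⟨Aug.ofGraded g hg hgd, ⟨K, fun k p hp =>
    derivation_mem_graded (pointGrading ρ) hK α.gen_mem hg hKgr hp, hK,
    fun p => (hh p).trans (by simp)⟩, Aug.ext hgi⟩

/-- Representatives of a class of augmentations of the larger DGA restrict to every representative
of the restricted class. -/
theorem AugClass.exists_rep (M : ImmersedMap A₁ A₂) (α : Aug M.B) (ε : Aug A₂)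
    (h : AugClass.pullback M.i (Quot.mk _ α) = Quot.mk _ ε) :
    ∃ α' : Aug M.B, (Quot.mk _ α' : AugClass M.B) = Quot.mk _ α ∧ α'.pullback M.i = ε := by
  -- Equality of classes only gives a zigzag of homotopies, so extension is iterated along it. Both
  -- directions are proved at once, so that reversing a link is harmless.
  have key : ∀ ε ε' : Aug A₂, Relation.EqvGen AugHomotopic ε ε' →
      ((∀ α : Aug M.B, α.pullback M.i = ε → ∃ α' : Aug M.B,
        (Quot.mk _ α' : AugClass M.B) = Quot.mk _ α ∧ α'.pullback M.i = ε') ∧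
      (∀ α : Aug M.B, α.pullback M.i = ε' → ∃ α' : Aug M.B,
        (Quot.mk _ α' : AugClass M.B) = Quot.mk _ α ∧ α'.pullback M.i = ε)) := by
    intro ε ε' h
    induction h with
    | rel ε ε' h =>
      refine ⟨?_, ?_⟩
      · rintro α rfl
        obtain ⟨α', h1, h2⟩ := h.exists_extension_right M α
        exact ⟨α', (Quot.sound h1).symm, h2⟩
      · rintro α rfl
        obtain ⟨α', h1, h2⟩ := h.exists_extension_left M α
        exact ⟨α', Quot.sound h1, h2⟩
    | refl ε => exact ⟨fun α h => ⟨α, rfl, h⟩, fun α h => ⟨α, rfl, h⟩⟩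
    | symm ε ε' _ ih => exact ⟨ih.2, ih.1⟩
    | trans ε ε' ε'' _ _ ih ih' =>
      refine ⟨fun α h => ?_, fun α h => ?_⟩
      · obtain ⟨α', h1, h2⟩ := ih.1 α h
        obtain ⟨α'', h3, h4⟩ := ih'.1 α' h2
        exact ⟨α'', h3.trans h1, h4⟩
      · obtain ⟨α', h1, h2⟩ := ih'.2 α h
        obtain ⟨α'', h3, h4⟩ := ih.2 α' h2
        exact ⟨α'', h3.trans h1, h4⟩
  exact (key _ _ (Quot.eqvGen_exact h)).1 α rfl

/-! ### Functoriality of the induced augmentation set -/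

/-- Augmentations of `B₁` and `B₂` that agree on `A₂` are induced by one of the push-out. -/
theorem exists_aug_pushout (M₂ : ImmersedMap A₂ A₃) (M₁ : ImmersedMap A₁ A₂) (α₁ : Aug M₁.B)
    (α₂ : Aug M₂.B) (h : α₁.pullback M₁.i = α₂.pullback M₂.f) :
    ∃ α : Aug (pushout M₂ M₁), α.pullback (pushHom₁ M₂ M₁) = α₁ ∧
      α.pullback (pushHom₂ M₂ M₁) = α₂ := by
  obtain ⟨g, ⟨h1, h2⟩, -⟩ := push_desc M₂ M₁ α₁.toAlgHom α₂.toAlgHom (congrArg Aug.toAlgHom h)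
  have e1 := DFunLike.congr_fun h1
  have e2 := DFunLike.congr_fun h2
  have hg : ∀ x : PushGen M₂ M₁, g (gen x) ∈ pointGrading ρ (pushDeg M₂ M₁ x) := by
    rintro (b | c)
    · have := e1 (gen b.1)
      rw [AlgHom.comp_apply, pushInl_new M₂ M₁ b.1 b.2] at this
      exact this.symm ▸ α₁.gen_mem b.1
    · have := e2 (gen c)
      rw [AlgHom.comp_apply, pushInr_gen] at this
      exact this.symm ▸ α₂.gen_mem c
  have hd : ∀ p, g (der (pushδ M₂ M₁) p) = 0 := by
    refine derivation_ext g g (g.toLinearMap ∘ₗ der (pushδ M₂ M₁)) 0 ?_ ?_ ?_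
    · intro p q; simp [der_mul]
    · simp
    · rintro (b | c)
      · rw [LinearMap.comp_apply, der_gen]
        exact (e1 _).trans (α₁.map_d _)
      · rw [LinearMap.comp_apply, der_gen]
        exact (e2 _).trans (α₂.map_d _)
  exact ⟨Aug.ofGraded (A := pushout M₂ M₁) g hg hd, Aug.ext h1, Aug.ext h2⟩

/-- An augmentation of the push-out restricts to `B₁` and `B₂`, and commutativity of the square
supplies the middle class. Conversely, two augmentations whose restrictions to `A₂` are only
equivalent must be made to agree before they can be glued. -/
theorem ImmersedMap.augSet_comp (M₂ : ImmersedMap A₂ A₃) (M₁ : ImmersedMap A₁ A₂) :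
    (M₂.comp M₁).augSet = {p | ∃ y, (p.1, y) ∈ M₂.augSet ∧ (y, p.2) ∈ M₁.augSet} := by
  have h : ∀ α : AugClass (pushout M₂ M₁),
      (AugClass.pullback (M₂.comp M₁).i α, AugClass.pullback (M₂.comp M₁).f α) =
      (AugClass.pullback M₂.i (AugClass.pullback (pushHom₂ M₂ M₁) α),
        AugClass.pullback M₁.f (AugClass.pullback (pushHom₁ M₂ M₁) α)) := fun α => by
    rw [comp_i, ← AugClass.pullback_comp, ← AugClass.pullback_comp]; rfl
  have h' : ∀ α : AugClass (pushout M₂ M₁), AugClass.pullback M₁.i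
      (AugClass.pullback (pushHom₁ M₂ M₁) α) =
      AugClass.pullback M₂.f (AugClass.pullback (pushHom₂ M₂ M₁) α) := fun α => by
    rw [← AugClass.pullback_comp, ← AugClass.pullback_comp, pushHom_square]
  refine Set.Subset.antisymm ?_ ?_
  · rintro _ ⟨α, rfl⟩
    exact ⟨AugClass.pullback M₂.f (AugClass.pullback (pushHom₂ M₂ M₁) α),
      ⟨_, Prod.ext (congrArg Prod.fst (h α)).symm rfl⟩,
      ⟨AugClass.pullback (pushHom₁ M₂ M₁) α, Prod.ext (h' α) (congrArg Prod.snd (h α)).symm⟩⟩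
  · rintro ⟨x, z⟩ ⟨y, ⟨a₂, h₂⟩, ⟨a₁, h₁⟩⟩
    obtain ⟨α₂, rfl⟩ := Quot.exists_rep a₂
    obtain ⟨α₁, rfl⟩ := Quot.exists_rep a₁
    obtain ⟨h3, h4⟩ := Prod.ext_iff.1 h₂
    obtain ⟨h5, h6⟩ := Prod.ext_iff.1 h₁
    -- It is `α₁` that is moved: `A₂` enters `B₁` through an inclusion of generators, where
    -- extension is available, whereas `f₂` is arbitrary.
    obtain ⟨α₁', h7, h8⟩ := AugClass.exists_rep M₁ α₁ (α₂.pullback M₂.f) (h5.trans h4.symm)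
    obtain ⟨α, h9, h10⟩ := exists_aug_pushout M₂ M₁ α₁' α₂ h8
    refine ⟨Quot.mk _ α, (h (Quot.mk _ α)).trans (Prod.ext ?_ ?_)⟩
    · refine Eq.trans ?_ h3
      exact congrArg (fun β : Aug M₂.B => AugClass.pullback M₂.i (Quot.mk _ β)) h10
    · refine Eq.trans ?_ h6
      refine Eq.trans (congrArg (fun β : Aug M₁.B => AugClass.pullback M₁.f (Quot.mk _ β)) h9) ?_
      exact congrArg (AugClass.pullback M₁.f) h7

theorem ImmersedMap.augSet_id (A : TriDGA.{u} ρ) : (ImmersedMap.id A).augSet = SetRel.id := by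
  have h : ∀ α : AugClass A, (AugClass.pullback (ImmersedMap.id A).i α,
      AugClass.pullback (ImmersedMap.id A).f α) = (α, α) := fun α => by
    rw [ImmersedMap.id_i]
    exact Prod.ext (AugClass.pullback_id α) (AugClass.pullback_id α)
  ext ⟨x, y⟩
  constructor
  · rintro ⟨α, hα⟩
    obtain ⟨h1, h2⟩ := Prod.ext_iff.1 ((h α).symm.trans hα)
    exact h1.symm.trans h2
  · intro hxy
    have hxy' : x = y := hxy
    exact ⟨x, (h x).trans (by rw [hxy'])⟩

/-- The contravariant functor sending a triangular DGA to its set of augmentations up to homotopy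
and an immersed homotopy class to its induced augmentation set. -/
def augFunctor (ρ : ℕ) : letI := (isCategory.{u} ρ).category; (DGAim.{u} ρ)ᵒᵖ ⥤ RelCat.{u} :=
  letI := (isCategory.{u} ρ).category
  { obj := fun A => AugClass A.unop
    map := fun {A₂ A₁} m => RelCat.Hom.ofRel (ImHom.augSet (A₁ := A₁.unop) (A₂ := A₂.unop) m.unop)
    map_id := fun A => congrArg RelCat.Hom.ofRel (ImmersedMap.augSet_id A.unop)
    map_comp := fun {A₃ A₂ A₁} m₂ m₁ => by
      obtain ⟨M₁, h₁⟩ := Quot.exists_rep m₁.unop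
      obtain ⟨M₂, h₂⟩ := Quot.exists_rep m₂.unop
      obtain rfl : m₁ = Quiver.Hom.op (Quot.mk _ M₁) := congrArg Quiver.Hom.op h₁.symm
      obtain rfl : m₂ = Quiver.Hom.op (Quot.mk _ M₂) := congrArg Quiver.Hom.op h₂.symm
      exact congrArg RelCat.Hom.ofRel (ImmersedMap.augSet_comp M₂ M₁) }

end Augmentations

end ImmersedDGA

/-! ### The category, the augmentation functor and the composition formula. -/

theorem mainTheorem10 (ρ : ℕ) :
    ∃ h : ImmersedDGA.IsCategory.{u} ρ,
      letI : Category.{u + 1} (ImmersedDGA.DGAim.{u} ρ) := h.category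
      (∃ F : (ImmersedDGA.DGAim.{u} ρ)ᵒᵖ ⥤ RelCat.{u},
        ∃ hF : ∀ A : ImmersedDGA.DGAim.{u} ρ,
          F.obj (Opposite.op A) = (ImmersedDGA.AugClass A : Type u),
        ∀ (A₁ A₂ : ImmersedDGA.DGAim.{u} ρ) (M : ImmersedDGA.ImmersedMap A₁ A₂),
          F.map (Quiver.Hom.op (M.cls : A₁ ⟶ A₂)) =
            eqToHom (hF A₂) ≫ RelCat.Hom.ofRel M.augSet ≫ eqToHom (hF A₁).symm) ∧
      (∀ (C : Type w) [Category.{v} C] (L : Cᵒᵖ ⥤ ImmersedDGA.DGAim.{u} ρ)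
        (Λ₁ Λ₂ Λ₃ : C) (S₂ : Λ₃ ⟶ Λ₂) (S₁ : Λ₂ ⟶ Λ₁)
        (M₁ : ImmersedDGA.ImmersedMap (L.obj (Opposite.op Λ₁)) (L.obj (Opposite.op Λ₂)))
        (M₂ : ImmersedDGA.ImmersedMap (L.obj (Opposite.op Λ₂)) (L.obj (Opposite.op Λ₃)))
        (M : ImmersedDGA.ImmersedMap (L.obj (Opposite.op Λ₁)) (L.obj (Opposite.op Λ₃))),
        L.map S₁.op = M₁.cls → L.map S₂.op = M₂.cls → L.map (S₂ ≫ S₁).op = M.cls →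
        M.augSet = {p | ∃ y, (p.1, y) ∈ M₂.augSet ∧ (y, p.2) ∈ M₁.augSet}) := by
  let := (ImmersedDGA.isCategory.{u} ρ).category
  refine ⟨ImmersedDGA.isCategory ρ, ⟨ImmersedDGA.augFunctor ρ, fun _ => rfl, fun A₁ A₂ M => ?_⟩, ?_⟩
  -- The object equalities hold by `rfl`, so both transports are identities.
  · exact ((Category.id_comp _).trans (Category.comp_id _)).symm
  · intro C _ L Λ₁ Λ₂ Λ₃ S₂ S₁ M₁ M₂ M h₁ h₂ h
    rw [← ImmersedDGA.ImmersedMap.augSet_comp]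
    -- Functoriality of `L` shows that `M` and `M₂.comp M₁` represent the same class, which
    -- determines the augmentation set.
    refine ImmersedDGA.ImmersedMap.augSet_eq_of_cls_eq (h.symm.trans ?_)
    rw [op_comp, L.map_comp, h₁, h₂]
    rfl
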